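/- **Proposition (cross-polytope, deciding existence).** For an integer $d\ge 0$, let $\mathsf{T}$ be the boundary of the $(d+1)$-dimensional cross-polytope $\operatorname{conv}\{\pm e_1,\dots,\pm e_{d+1}\}\subset\mathbb{R}^{d+1}$, where $e_1,\dots,e_{d+1}$ is the standard orthonormal basis; its simplices are the nonempty vertex sets $\sigma\subseteq V(\mathsf{T})=\{\pm e_1,\dots,\pm e_{d+1}\}$ whose convex hull is a proper face of the cross-polytope. For a labeling $\lambda:V(\mathsf{T})\to\{1,\dots,d+1\}$, a *fully-labeled simplex* is a $d$-dimensional simplex of $\mathsf{T}$ (one with $d+1$ vertices) whose vertices get pairwise distinct labels. An instance consists of an arbitrary $d$ and an arbitrary labeling $\lambda$, given by the list of the labels of $e_1,-e_1,e_2,-e_2,\dots,e_{d+1},-e_{d+1}$ written in binary (the label $k$ as the binary expansion of $k-1$) and separated by a special symbol. Then: 1. Deciding whether there is a fully-labeled simplex can be done in polynomial time: there is a (multi-stack) Turing machine that, on every instance, outputs whether a fully-labeled simplex exists, in a number of steps bounded by a polynomial in the length of the input. 2. If there is a fully-labeled simplex, one can be found in polynomial time: there is a (multi-stack) Turing machine,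 running in a number of steps bounded by a polynomial in the length of the input, that outputs a fully-labeled simplex on every instance that has one (and the answer "none" on every other instance). -/

import Mathlib

/-- The index set of the `2 (d + 1)` vertices of the `(d + 1)`-dimensional cross-polytope: `(i, true)`
stands for the vertex `e_i` and `(i, false)` for the antipodal vertex `-e_i`. -/
abbrev CrossVertex (d : ℕ) : Type := Fin (d + 1) × Bool

/-- The position of a vertex: `e_i` or `-e_i`. -/
noncomputable def CrossVertex.pos {d : ℕ} (v : CrossVertex d) : EuclideanSpace ℝ (Fin (d + 1)) :=
  if v.2 then EuclideanSpace.single v.1 1 else -EuclideanSpace.single v.1 1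

/-- The `(d + 1)`-dimensional cross-polytope: the convex hull of the vectors of the standard
orthonormal basis of `ℝ^(d+1)` and their negatives. -/
def crossPolytope (d : ℕ) : Set (EuclideanSpace ℝ (Fin (d + 1))) :=
  convexHull ℝ (Set.range (CrossVertex.pos (d := d)))

/-- The simplices of the boundary of the cross-polytope: the nonempty sets of vertices whose convex
hull is a proper face of the cross-polytope. -/
def IsCrossBoundarySimplex {d : ℕ} (s : Finset (CrossVertex d)) : Prop :=
  s.Nonempty ∧
    IsExposed ℝ (crossPolytope d) (convexHull ℝ (CrossVertex.pos '' (s : Set (CrossVertex d)))) ∧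
    convexHull ℝ (CrossVertex.pos '' (s : Set (CrossVertex d))) ≠ crossPolytope d

/-- A labeling of the vertices of the cross-polytope with `d + 1` labels; the element of
`Fin (d + 1)` with value `k` stands for the label `k + 1` of `{1, …, d + 1}`. -/
abbrev CrossLabeling (d : ℕ) : Type := CrossVertex d → Fin (d + 1)

/-- A fully-labeled simplex: a `d`-dimensional simplex (that is, with `d + 1` vertices) of the
boundary of the cross-polytope whose vertices get pairwise distinct labels. -/
def IsFullyLabeled {d : ℕ} (lab : CrossLabeling d) (s : Finset (CrossVertex d)) : Prop :=
  IsCrossBoundarySimplex s ∧ s.card = d + 1 ∧ Set.InjOn lab (s : Set (CrossVertex d))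

/-- An instance of the problem: a number `d` and a labeling of the vertices of the
`(d + 1)`-dimensional cross-polytope. -/
structure LabeledCrossPolytope where
  d : ℕ
  label : CrossLabeling d

/-- A label written in binary, followed by the separator `none`. -/
def encodeCrossLabel {d : ℕ} (k : Fin (d + 1)) : List (Option Bool) :=
  (Computability.encodeNat k).map some ++ [none]

/-- The input string of the algorithms: the labels of `e_1, -e_1, e_2, -e_2, …, e_{d+1}, -e_{d+1}`
in this order, in binary and separated, over the three-letter alphabet `Option Bool`. -/
def encodeLabeledCrossPolytope (I : LabeledCrossPolytope) : List (Option Bool) :=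
  (List.finRange (I.d + 1)).flatMap fun i =>
    encodeCrossLabel (I.label (i, true)) ++ encodeCrossLabel (I.label (i, false))

/-- The output string of a search algorithm: the empty string for the answer "none", and the
indicator vector of `s` on the list `e_1, -e_1, e_2, -e_2, …` for a set `s` of vertices. -/
def encodeCrossAnswer {d : ℕ} : Option (Finset (CrossVertex d)) → List Bool
  | none => []
  | some s => (List.finRange (d + 1)).flatMap fun i =>
      [decide ((i, true) ∈ s), decide ((i, false) ∈ s)]

theorem encodeCrossLabel_append_inj {d e : ℕ} {k : Fin (d + 1)} {l : Fin (e + 1)}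
    {u v : List (Option Bool)} (h : encodeCrossLabel k ++ u = encodeCrossLabel l ++ v) :
    k.val = l.val ∧ u = v := by
  have key : ∀ (a b : List Bool) (u v : List (Option Bool)),
      a.map some ++ none :: u = b.map some ++ none :: v → a = b ∧ u = v := by
    intro a
    induction a with
    | nil => intro b u v h; cases b <;> simp_all
    | cons x a ih =>
      intro b u v h
      cases b with
      | nil => simp at h
      | cons y b =>
        simp only [List.map_cons, List.cons_append, List.cons.injEq, Option.some.injEq] at h
        obtain ⟨h1, h2⟩ := ih b u v h.2
        exact ⟨by rw [h.1, h1], h2⟩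
  simp only [encodeCrossLabel, List.append_assoc, List.singleton_append] at h
  obtain ⟨h1, h2⟩ := key _ _ _ _ h
  refine ⟨?_, h2⟩
  have := congrArg Computability.decodeNat h1
  simpa using this

/-- The input string determines the instance. -/
theorem encodeLabeledCrossPolytope_injective :
    Function.Injective encodeLabeledCrossPolytope := by
  have key : ∀ (d e : ℕ) (f : CrossLabeling d) (g : CrossLabeling e) (m : List (Fin (d + 1)))
      (n : List (Fin (e + 1))),
      (m.flatMap fun i => encodeCrossLabel (f (i, true)) ++ encodeCrossLabel (f (i, false))) =
        (n.flatMap fun i => encodeCrossLabel (g (i, true)) ++ encodeCrossLabel (g (i, false))) →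
      m.map (fun i => ((f (i, true)).val, (f (i, false)).val)) =
        n.map (fun i => ((g (i, true)).val, (g (i, false)).val)) := by
    intro d e f g m
    induction m with
    | nil =>
      intro n h
      cases n with
      | nil => rfl
      | cons y n => simp [encodeCrossLabel] at h
    | cons x m ih =>
      intro n h
      cases n with
      | nil => simp [encodeCrossLabel] at h
      | cons y n =>
        simp only [List.flatMap_cons, List.append_assoc] at h
        obtain ⟨h1, h⟩ := encodeCrossLabel_append_inj h
        obtain ⟨h2, h⟩ := encodeCrossLabel_append_inj h
        simp [h1, h2, ih n h]
  rintro ⟨d, f⟩ ⟨e, g⟩ h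
  have h' := key d e f g _ _ h
  have hde : d = e := by simpa using congrArg List.length h'
  subst hde
  have h2 : ∀ i, f (i, true) = g (i, true) ∧ f (i, false) = g (i, false) := by
    simpa [List.map_inj_left, Fin.val_inj] using h'
  have hfg : f = g := by
    funext ⟨i, b⟩
    cases b
    · exact (h2 i).2
    · exact (h2 i).1
  rw [hfg]

/-- The output string determines the answer. -/
theorem encodeCrossAnswer_injective {d : ℕ} :
    Function.Injective (encodeCrossAnswer (d := d)) := by
  have key : ∀ (s t : Finset (CrossVertex d)) (m : List (Fin (d + 1))),
      (m.flatMap fun i => [decide ((i, true) ∈ s), decide ((i, false) ∈ s)]) =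
        (m.flatMap fun i => [decide ((i, true) ∈ t), decide ((i, false) ∈ t)]) →
      ∀ i ∈ m, ∀ b, ((i, b) ∈ s ↔ (i, b) ∈ t) := by
    intro s t m
    induction m with
    | nil => simp
    | cons x m ih =>
      intro h i hi b
      simp only [List.flatMap_cons, List.cons_append, List.nil_append, List.cons.injEq,
        decide_eq_decide] at h
      rcases List.mem_cons.1 hi with rfl | hi
      · cases b
        · exact h.2.1
        · exact h.1
      · exact ih h.2.2 i hi b
  intro a b h
  cases a with
  | none => cases b with
    | none => rfl
    | some t => simp [encodeCrossAnswer, List.finRange_succ] at h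
  | some s => cases b with
    | none => simp [encodeCrossAnswer, List.finRange_succ] at h
    | some t =>
      congr 1
      ext ⟨i, b⟩
      exact key s t _ h i (List.mem_finRange i) b

/-! A simplex with `d + 1` vertices on the boundary of the cross-polytope contains exactly one of
`e_i`, `-e_i` for each `i`, and every such choice gives a facet
(`IsFullyLabeled.exists_eq_crossFacet`, `isCrossBoundarySimplex_crossFacet`). So the labels are the
nodes of a multigraph in which the axis `i` is an edge joining the labels of `e_i` and `-e_i`. A
fully-labeled simplex is a choice of one end of each edge such that the chosen ends are distinct.

Such a choice is found as in cuckoo hashing. The edges are inserted one after the other. A new edge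
occupies its first label; if another edge holds that label, it is kicked out and moves to its other
end, and so on. Suppose that a solution `f` exists. If the edge that moved last sits at its label
under `f`, the edge it kicks out was misplaced, so it moves to its correct label and the number of
correct edges grows. If it sits at a wrong label, each kick either reaches the first situation or
moves a correct edge to its wrong end. Hence `potential` drops at every kick (`potential_kick_lt`).
As it is at most twice the number of inserted edges, more kicks than that refute the existence of a
solution.

The kicks are rationed by a unary stack of fuel, refilled at every insertion by at least twice the
number of inserted edges. Each kick or insertion costs one pass over the input, in quadratic time,
and there are quadratically many passes (`exec_insertAll_of_isHead`). The procedure is written in a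
small structured language whose programs compile to multi-stack machines, one big-semantics step
being one machine step (`Runs.iterate_step`). -/

open Turing

/-! ### Structured stack programs and their big-step semantics. -/

/-- Structured programs over finitely many stacks (indexed by `W`, with letters in `A`), a finite
memory `σ` and a write-only output stack with letters in `B`. -/
inductive StackProg (W A B σ : Type) : Type
  | load (f : σ → σ)
  | push (k : W) (f : σ → A)
  | pop (k : W) (f : σ → Option A → σ)
  | emit (f : σ → B)
  | seq (p q : StackProg W A B σ)
  | ite (c : σ → Bool) (p q : StackProg W A B σ)
  | loop (c : σ → Bool) (p : StackProg W A B σ)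

namespace StackProg

variable {W A B σ : Type}

/-- The memory, the stacks and the output of a structured program. -/
structure State (W A B σ : Type) : Type where
  var : σ
  stk : W → List A
  out : List B

section Semantics

variable [DecidableEq W]

/-- Big-step semantics: `Runs p x y t` says that `p` started in `x` ends in `y` after `t` steps. -/
inductive Runs : StackProg W A B σ → State W A B σ → State W A B σ → ℕ → Prop
  | load (f : σ → σ) (v : σ) (S : W → List A) (o : List B) :
      Runs (load f) ⟨v, S, o⟩ ⟨f v, S, o⟩ 1
  | push (k : W) (f : σ → A) (v : σ) (S : W → List A) (o : List B) :
      Runs (push k f) ⟨v, S, o⟩ ⟨v, Function.update S k (f v :: S k), o⟩ 1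
  | pop (k : W) (f : σ → Option A → σ) (v : σ) (S : W → List A) (o : List B) :
      Runs (pop k f) ⟨v, S, o⟩ ⟨f v (S k).head?, Function.update S k (S k).tail, o⟩ 1
  | emit (f : σ → B) (v : σ) (S : W → List A) (o : List B) :
      Runs (emit f) ⟨v, S, o⟩ ⟨v, S, f v :: o⟩ 1
  | seq {p q : StackProg W A B σ} {x y z : State W A B σ} {s t : ℕ} :
      Runs p x y s → Runs q y z t → Runs (seq p q) x z (s + t)
  | ite_true {c : σ → Bool} {p q : StackProg W A B σ} {x y : State W A B σ} {t : ℕ} :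
      c x.var = true → Runs p x y t → Runs (ite c p q) x y (1 + t)
  | ite_false {c : σ → Bool} {p q : StackProg W A B σ} {x y : State W A B σ} {t : ℕ} :
      c x.var = false → Runs q x y t → Runs (ite c p q) x y (1 + t)
  | loop_exit {c : σ → Bool} {p : StackProg W A B σ} {x : State W A B σ} :
      c x.var = false → Runs (loop c p) x x 1
  | loop_step {c : σ → Bool} {p : StackProg W A B σ} {x y z : State W A B σ} {s t : ℕ} :
      c x.var = true → Runs p x y s → Runs (loop c p) y z t → Runs (loop c p) x z (1 + s + t)

/-- `Exec p x y t` says that `p` started in `x` ends in `y` after at most `t` steps. -/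
def Exec (p : StackProg W A B σ) (x y : State W A B σ) (t : ℕ) : Prop :=
  ∃ s ≤ t, Runs p x y s

variable {p q : StackProg W A B σ} {x y z : State W A B σ} {c : σ → Bool} {s t : ℕ}

theorem Exec.mono (h : Exec p x y s) (hst : s ≤ t) : Exec p x y t :=
  let ⟨r, hr, h⟩ := h
  ⟨r, hr.trans hst, h⟩

theorem Exec.congr (h : Exec p x y s) (hy : y = z) (hst : s ≤ t) : Exec p x z t :=
  hy ▸ h.mono hst

theorem Exec.congr_left (hx : z = x) (h : Exec p x y s) : Exec p z y s :=
  hx ▸ h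

theorem Exec.seq (h₁ : Exec p x y s) (h₂ : Exec q y z t) : Exec (seq p q) x z (s + t) :=
  let ⟨_, hr, h₁⟩ := h₁
  let ⟨_, hr', h₂⟩ := h₂
  ⟨_, Nat.add_le_add hr hr', h₁.seq h₂⟩

theorem Exec.ite_true (hc : c x.var = true) (h : Exec p x y t) : Exec (ite c p q) x y (t + 1) :=
  let ⟨_, hr, h⟩ := h
  ⟨_, by omega, h.ite_true hc⟩

theorem Exec.ite_false (hc : c x.var = false) (h : Exec q x y t) : Exec (ite c p q) x y (t + 1) :=
  let ⟨_, hr, h⟩ := h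
  ⟨_, by omega, h.ite_false hc⟩

theorem Exec.loop_exit (hc : c x.var = false) : Exec (loop c p) x x 1 :=
  ⟨_, le_rfl, .loop_exit hc⟩

theorem Exec.loop_step (hc : c x.var = true) (h₁ : Exec p x y s) (h₂ : Exec (loop c p) y z t) :
    Exec (loop c p) x z (s + t + 1) :=
  let ⟨_, hr, h₁⟩ := h₁
  let ⟨_, hr', h₂⟩ := h₂
  ⟨_, by omega, .loop_step hc h₁ h₂⟩

theorem exec_load (f : σ → σ) (v : σ) (S : W → List A) (o : List B) :
    Exec (.load f) ⟨v, S, o⟩ ⟨f v, S, o⟩ 1 :=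
  ⟨_, le_rfl, .load f v S o⟩

theorem exec_push (k : W) (f : σ → A) (v : σ) (S : W → List A) (o : List B) :
    Exec (.push k f) ⟨v, S, o⟩ ⟨v, Function.update S k (f v :: S k), o⟩ 1 :=
  ⟨_, le_rfl, .push k f v S o⟩

theorem exec_pop (k : W) (f : σ → Option A → σ) (v : σ) (S : W → List A) (o : List B) :
    Exec (.pop k f) ⟨v, S, o⟩ ⟨f v (S k).head?, Function.update S k (S k).tail, o⟩ 1 :=
  ⟨_, le_rfl, .pop k f v S o⟩

theorem exec_emit (f : σ → B) (v : σ) (S : W → List A) (o : List B) :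
    Exec (.emit f) ⟨v, S, o⟩ ⟨v, S, f v :: o⟩ 1 :=
  ⟨_, le_rfl, .emit f v S o⟩

end Semantics

/-! ### Compilation to multi-stack Turing machines. -/

section Compilation

/-- The labels of the compiled program. -/
def Label : StackProg W A B σ → Type
  | load _ => Unit
  | push _ _ => Unit
  | pop _ _ => Unit
  | emit _ => Unit
  | seq p q => Label p ⊕ Label q
  -- The extra label `none`, here and for `loop`, is the place of the test.
  | ite _ p q => Option (Label p ⊕ Label q)
  | loop _ p => Option (Label p)

/-- There are finitely many labels. -/
@[reducible]
def labelFintype : (p : StackProg W A B σ) → Fintype (Label p)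
  | load _ => inferInstanceAs (Fintype Unit)
  | push _ _ => inferInstanceAs (Fintype Unit)
  | pop _ _ => inferInstanceAs (Fintype Unit)
  | emit _ => inferInstanceAs (Fintype Unit)
  | seq p q =>
    letI := labelFintype p
    letI := labelFintype q
    inferInstanceAs (Fintype (Label p ⊕ Label q))
  | ite _ p q =>
    letI := labelFintype p
    letI := labelFintype q
    inferInstanceAs (Fintype (Option (Label p ⊕ Label q)))
  | loop _ p =>
    letI := labelFintype p
    inferInstanceAs (Fintype (Option (Label p)))

/-- The label at which the compiled program starts. -/
def entry : (p : StackProg W A B σ) → Label p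
  | load _ => ()
  | push _ _ => ()
  | pop _ _ => ()
  | emit _ => ()
  | seq p _ => Sum.inl (entry p)
  | ite _ _ _ => (none : Option _)
  | loop _ _ => (none : Option _)

/-- The alphabets of the compiled machine, whose stack `none` is the output stack. -/
def Alphabet (W A B : Type) : Option W → Type
  | none => B
  | some _ => A

/-- The code of a structured program with labels embedded by `emb` that jumps to `exit` at its
end. -/
def code {Λ : Type} : (p : StackProg W A B σ) → (Label p → Λ) → Λ → Label p →
    TM2.Stmt (Alphabet W A B) Λ σ
  | load f, _, exit, _ => .load f (.goto fun _ => exit)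
  | push k f, _, exit, _ => .push (some k) f (.goto fun _ => exit)
  | pop k f, _, exit, _ => .pop (some k) f (.goto fun _ => exit)
  | emit f, _, exit, _ => .push none f (.goto fun _ => exit)
  | seq p q, emb, _, Sum.inl l => code p (fun l => emb (Sum.inl l)) (emb (Sum.inr (entry q))) l
  | seq _ q, emb, exit, Sum.inr l => code q (fun l => emb (Sum.inr l)) exit l
  | ite c p q, emb, _, none =>
    .branch c (.goto fun _ => emb (some (Sum.inl (entry p))))
      (.goto fun _ => emb (some (Sum.inr (entry q))))
  | ite _ p _, emb, exit, some (Sum.inl l) => code p (fun l => emb (some (Sum.inl l))) exit l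
  | ite _ _ q, emb, exit, some (Sum.inr l) => code q (fun l => emb (some (Sum.inr l))) exit l
  | loop c p, emb, exit, none =>
    .branch c (.goto fun _ => emb (some (entry p))) (.goto fun _ => exit)
  | loop _ p, emb, _, some l => code p (fun l => emb (some l)) (emb none) l

/-- The stacks of the compiled machine. -/
def State.stacks (x : State W A B σ) : (k : Option W) → List (Alphabet W A B k)
  | none => x.out
  | some k => x.stk k

/-- The configuration of the compiled machine at a label. -/
def State.cfg {Λ : Type} (x : State W A B σ) (l : Option Λ) : TM2.Cfg (Alphabet W A B) Λ σ :=
  ⟨l, x.var, x.stacks⟩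

variable [DecidableEq W]

theorem stacks_update_some (v : σ) (S : W → List A) (o : List B) (k : W) (l : List A) :
    Function.update (State.stacks ⟨v, S, o⟩) (some k) l =
      State.stacks (σ := σ) ⟨v, Function.update S k l, o⟩ := by
  funext j
  by_cases h : j = some k
  · subst h
    exact (Function.update_self _ _ _).trans (Function.update_self (f := S) k l).symm
  · refine (Function.update_of_ne h _ _).trans ?_
    cases j with
    | none => rfl
    | some j => exact (Function.update_of_ne (fun hj => h (congrArg some hj)) l S).symm

theorem stacks_update_none (v : σ) (S : W → List A) (o l : List B) :
    Function.update (State.stacks ⟨v, S, o⟩) none l = State.stacks (σ := σ) ⟨v, S, l⟩ := by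
  funext j
  cases j with
  | none => exact Function.update_self _ _ _
  | some j => exact Function.update_of_ne (Option.some_ne_none j) _ _

/-- Induction on the run. The embedding of the labels and the exit are universally quantified
because each subprogram is compiled with its own: the first half of `seq` exits to the entry of the
second, and the body of a loop exits to its test. -/
theorem Runs.iterate_step {Λ : Type} {M : Λ → TM2.Stmt (Alphabet W A B) Λ σ}
    {p : StackProg W A B σ} {x y : State W A B σ} {t : ℕ} (h : Runs p x y t) :
    ∀ {emb : Label p → Λ} {exit : Λ}, (∀ l, M (emb l) = code p emb exit l) →
      (flip bind (TM2.step M))^[t] (some (x.cfg (some (emb (entry p))))) =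
        some (y.cfg (some exit)) := by
  induction h with
  | load f v S o =>
    intro emb exit hM
    change some (TM2.stepAux (M (emb (entry (.load f)))) v (State.stacks ⟨v, S, o⟩)) = _
    rw [hM]
    exact rfl
  | push k f v S o =>
    intro emb exit hM
    change some (TM2.stepAux (M (emb (entry (.push k f)))) v (State.stacks ⟨v, S, o⟩)) = _
    rw [hM]
    exact congrArg (fun T => some (TM2.Cfg.mk (some exit) v T))
      (stacks_update_some v S o k (f v :: S k))
  | pop k f v S o =>
    intro emb exit hM
    change some (TM2.stepAux (M (emb (entry (.pop k f)))) v (State.stacks ⟨v, S, o⟩)) = _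
    rw [hM]
    exact congrArg (fun T => some (TM2.Cfg.mk (some exit) (f v (S k).head?) T))
      (stacks_update_some v S o k (S k).tail)
  | emit f v S o =>
    intro emb exit hM
    change some (TM2.stepAux (M (emb (entry (.emit f)))) v (State.stacks ⟨v, S, o⟩)) = _
    rw [hM]
    exact congrArg (fun T => some (TM2.Cfg.mk (some exit) v T))
      (stacks_update_none v S o (f v :: o))
  | @seq p q x y z s t _ _ ih₁ ih₂ =>
    intro emb exit hM
    have h₁ := ih₁ (emb := fun l => emb (Sum.inl l)) (exit := emb (Sum.inr (entry q)))
      fun l => hM (Sum.inl l)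
    have h₂ := ih₂ (emb := fun l => emb (Sum.inr l)) (exit := exit) fun l => hM (Sum.inr l)
    rw [add_comm, Function.iterate_add_apply]
    exact (congrArg _ h₁).trans h₂
  | @ite_true c p q x y t hc _ ih =>
    intro emb exit hM
    have h := ih (emb := fun l => emb (some (Sum.inl l))) (exit := exit)
      fun l => hM (some (Sum.inl l))
    rw [add_comm, Function.iterate_add_apply]
    refine (congrArg _ ?_).trans h
    have := hM none
    simp [flip, State.cfg, entry, TM2.step, this, code, hc]
  | @ite_false c p q x y t hc _ ih =>
    intro emb exit hM
    have h := ih (emb := fun l => emb (some (Sum.inr l))) (exit := exit)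
      fun l => hM (some (Sum.inr l))
    rw [add_comm, Function.iterate_add_apply]
    refine (congrArg _ ?_).trans h
    have := hM none
    simp [flip, State.cfg, entry, TM2.step, this, code, hc]
  | @loop_exit c p x hc =>
    intro emb exit hM
    have := hM none
    simp [flip, State.cfg, entry, TM2.step, this, code, hc]
  | @loop_step c p x y z s t hc _ _ ih₁ ih₂ =>
    intro emb exit hM
    have h₁ := ih₁ (emb := fun l => emb (some l)) (exit := emb none) fun l => hM (some l)
    have h₂ := ih₂ hM
    have h₀ : (flip bind (TM2.step M))^[1] (some (x.cfg (some (emb none)))) =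
        some (x.cfg (some (emb (some (entry p))))) := by
      have := hM none
      simp [flip, State.cfg, TM2.step, this, code, hc]
    rw [add_comm, Function.iterate_add_apply, add_comm, Function.iterate_add_apply]
    refine (congrArg _ ?_).trans h₂
    exact (congrArg _ h₀).trans h₁

/-- The machine that executes a structured program with input stack `k₀`. -/
def machine [Fintype W] [Fintype A] [Fintype σ] (p : StackProg W A B σ) (k₀ : W) (v₀ : σ) :
    FinTM2 :=
  letI := labelFintype p
  { K := Option W
    k₀ := some k₀
    k₁ := none
    Γ := Alphabet W A B
    Λ := Option (Label p)
    main := some (entry p)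
    σ := σ
    initialState := v₀
    Γk₀Fin := inferInstanceAs (Fintype A)
    m := fun l => match l with
      | none => .halt
      | some l => code p some none l }

/-- The final state has the initial memory and empty work stacks because `haltList` prescribes
exactly that. -/
theorem nonempty_tm2ComputableInPolyTime [Fintype W] [Fintype A] [Fintype σ] {α β : Type}
    {ea : α → List A} {eb : β → List B} {f : α → β} (p : StackProg W A B σ) (k₀ : W) (v₀ : σ)
    (time : Polynomial ℕ)
    (h : ∀ a, Exec p ⟨v₀, Function.update (fun _ => []) k₀ (ea a), []⟩ ⟨v₀, fun _ => [], eb (f a)⟩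
      (time.eval (ea a).length)) :
    Nonempty (TM2ComputableInPolyTime ea eb f) := by
  have key : ∀ a, Nonempty (TM2OutputsInTime (machine p k₀ v₀)
      (List.map (Equiv.refl A).invFun (ea a)) (some (List.map (Equiv.refl B).invFun (eb (f a))))
      ((time + 1).eval (ea a).length)) := by
    intro a
    obtain ⟨t, ht, hr⟩ := h a
    have hM := hr.iterate_step (M := (machine (B := B) p k₀ v₀).m) (emb := some) (exit := none)
      fun l => rfl
    -- The additional step executes `halt` at the label `none`.
    refine ⟨⟨⟨1 + t, ?_⟩, ?_⟩⟩
    · have h₁ : initList (machine p k₀ v₀) (List.map (Equiv.refl A).invFun (ea a)) =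
          State.cfg (⟨v₀, Function.update (fun _ => []) k₀ (ea a), []⟩ : State W A B σ)
            (some (some (entry p))) := by
        unfold initList State.cfg
        congr 1
        funext k
        by_cases hk : k = some k₀
        · subst hk
          refine (dif_pos rfl).trans ?_
          exact (List.map_id _).trans (Function.update_self k₀ (ea a) fun _ => []).symm
        · refine (dif_neg hk).trans ?_
          cases k with
          | none => rfl
          | some k =>
            exact (Function.update_of_ne (fun h => hk (congrArg some h)) (ea a) fun _ => []).symm
      have h₂ : haltList (machine p k₀ v₀) (List.map (Equiv.refl B).invFun (eb (f a))) =
          State.cfg (⟨v₀, fun _ => [], eb (f a)⟩ : State W A B σ) none := by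
        unfold haltList State.cfg
        congr 1
        funext k
        cases k with
        | none => exact (dif_pos rfl).trans (List.map_id _)
        | some k => rfl
      rw [Function.iterate_add_apply]
      have h₃ : ((flip bind (machine (B := B) p k₀ v₀).step)^[t]
          (some (initList (machine p k₀ v₀) (List.map (Equiv.refl A).invFun (ea a))))) =
          some (State.cfg (⟨v₀, fun _ => [], eb (f a)⟩ : State W A B σ) (some none)) := by
        rw [h₁]
        exact hM
      refine (congrArg _ h₃).trans ?_
      simp only [Option.map_some]
      rw [h₂]
      rfl
    · simp only [Polynomial.eval_add, Polynomial.eval_one]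
      omega
  exact ⟨⟨⟨machine p k₀ v₀, Equiv.refl A, Equiv.refl B⟩, time + 1, fun a => (key a).some⟩⟩

end Compilation

end StackProg

/-! ### Reading, moving and comparing words on stacks. -/

/-- The memory of the cuckoo program: two letters read from stacks and six flags. -/
structure CuckooMem : Type where
  buf : Option (Option Bool)
  buf' : Option (Option Bool)
  eq : Bool
  cur : Bool
  mov : Bool
  found : Bool
  go : Bool
  ok : Bool

noncomputable instance : Fintype CuckooMem :=
  Fintype.ofInjective (fun v => (v.buf, v.buf', v.eq, v.cur, v.mov, v.found, v.go, v.ok)) (by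
    rintro ⟨⟩ ⟨⟩ h
    simpa using h)

/-- The stacks of the cuckoo program: the unread and the read part of the input, the unread and the
read part of the flags, the current and the other label of an edge, the label that is being
occupied, an auxiliary stack, and a unary counter. -/
inductive CuckooStack : Type
  | inp | past | todo | seen | here | there | goal | tmp | fuel
  deriving DecidableEq

instance : Fintype CuckooStack where
  elems := {.inp, .past, .todo, .seen, .here, .there, .goal, .tmp, .fuel}
  complete k := by cases k <;> decide

namespace StackProg

variable {W B : Type} [DecidableEq W]

/-- Do nothing. -/
def skip : StackProg W (Option Bool) B CuckooMem := .load id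

/-- Put the letter read before on a stack. -/
def unread (k : W) : StackProg W (Option Bool) B CuckooMem := .push k fun v => v.buf.getD none

/-- Read a letter from a stack. -/
def read (k : W) : StackProg W (Option Bool) B CuckooMem := .pop k fun v a => { v with buf := a }

/-- Read a stack and execute `p` after each letter, as long as the letters satisfy `c`. -/
def readWhile (c : Option (Option Bool) → Bool) (k : W)
    (p : StackProg W (Option Bool) B CuckooMem) : StackProg W (Option Bool) B CuckooMem :=
  .seq (read k) (.loop (fun v => c v.buf) (.seq p (read k)))

/-- Read a stack to its end and execute `p` after each letter. -/
def drain (k : W) (p : StackProg W (Option Bool) B CuckooMem) :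
    StackProg W (Option Bool) B CuckooMem :=
  readWhile Option.isSome k p

/-- Move a stack to another one, in reverse order. -/
def moveAll (i j : W) : StackProg W (Option Bool) B CuckooMem := drain i (unread j)

/-- Empty a stack. -/
def clear (i : W) : StackProg W (Option Bool) B CuckooMem := drain i skip

/-- Move a word and the separator after it from `i` to `j` and copy the word to `k`. -/
def readWord (i j k : W) : StackProg W (Option Bool) B CuckooMem :=
  .seq (readWhile (fun a => a.any Option.isSome) i (.seq (unread j) (unread k)))
    (.seq (.push j fun _ => none) (.load fun v => { v with buf := none }))

/-- Test whether `i` and `j` are equal; `i` is emptied, and `k` is an auxiliary stack. -/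
def eqTest (i j k : W) : StackProg W (Option Bool) B CuckooMem :=
  .seq (.load fun v => { v with eq := true })
    (.seq (drain i (.seq (.pop j fun v a => { v with buf' := a })
        (.seq (.load fun v => { v with eq := v.eq && v.buf == v.buf' })
          (.ite (fun v => v.buf'.isSome) (.push k fun v => v.buf'.getD none) skip))))
      (.seq (drain j (.seq (.load fun v => { v with eq := false }) (unread k)))
        (.seq (moveAll k j) (.load fun v => { v with buf' := none }))))

theorem exec_skip (x : State W (Option Bool) B CuckooMem) : Exec skip x x 1 :=
  exec_load id x.var x.stk x.out

theorem exec_unread (k : W) (v : CuckooMem) (S : W → List (Option Bool)) (o : List B) :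
    Exec (unread k) ⟨v, S, o⟩ ⟨v, Function.update S k (v.buf.getD none :: S k), o⟩ 1 :=
  exec_push k _ v S o

theorem exec_readWhile_exit {c : Option (Option Bool) → Bool} {k : W}
    {p : StackProg W (Option Bool) B CuckooMem} {v : CuckooMem} {S : W → List (Option Bool)}
    {o : List B} (hc : c (S k).head? = false) :
    Exec (readWhile c k p) ⟨v, S, o⟩
      ⟨{ v with buf := (S k).head? }, Function.update S k (S k).tail, o⟩ 2 :=
  (exec_pop k _ v S o).seq (.loop_exit hc)

/-- After `p`, the program reads again and returns to the test, which is what a fresh `readWhile`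
does. So the run `h₂` is cut after its first read, and the two pieces are regrouped inside the loop.
-/
theorem exec_readWhile_step {c : Option (Option Bool) → Bool} {k : W}
    {p : StackProg W (Option Bool) B CuckooMem} {v : CuckooMem} {S : W → List (Option Bool)}
    {o : List B} {a : Option Bool} {l : List (Option Bool)}
    {y z : State W (Option Bool) B CuckooMem}
    {s t : ℕ} (hS : S k = a :: l) (hc : c (some a) = true)
    (h₁ : Exec p ⟨{ v with buf := some a }, Function.update S k l, o⟩ y s)
    (h₂ : Exec (readWhile c k p) y z t) :
    Exec (readWhile c k p) ⟨v, S, o⟩ z (s + t + 2) := by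
  obtain ⟨t', ht', h₂⟩ := h₂
  cases h₂ with
  | @seq _ _ _ y' _ s' t'' h₃ h₄ =>
    have h₅ : s' = 1 := by cases h₃; rfl
    have h₆ := exec_pop k (fun (v : CuckooMem) (a : Option (Option Bool)) => { v with buf := a })
      v S o
    rw [hS] at h₆
    refine (h₆.seq (.loop_step hc (h₁.seq ⟨s', le_rfl, h₃⟩) ⟨t'', le_rfl, h₄⟩)).mono ?_
    omega

theorem exec_drain_nil {k : W} {p : StackProg W (Option Bool) B CuckooMem} {v : CuckooMem}
    {S : W → List (Option Bool)} {o : List B} (hS : S k = []) :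
    Exec (drain k p) ⟨v, S, o⟩ ⟨{ v with buf := none }, S, o⟩ 2 := by
  have h := exec_readWhile_exit (c := Option.isSome) (k := k) (p := p) (v := v) (S := S) (o := o)
    (by simp [hS])
  rw [hS] at h
  have h' : Function.update S k ([] : List (Option Bool)).tail = S := by
    rw [List.tail_nil, ← hS, Function.update_eq_self]
  rwa [h'] at h

theorem exec_drain_cons {k : W} {p : StackProg W (Option Bool) B CuckooMem} {v : CuckooMem}
    {S : W → List (Option Bool)} {o : List B} {a : Option Bool} {l : List (Option Bool)}
    {y z : State W (Option Bool) B CuckooMem} {s t : ℕ} (hS : S k = a :: l)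
    (h₁ : Exec p ⟨{ v with buf := some a }, Function.update S k l, o⟩ y s)
    (h₂ : Exec (drain k p) y z t) : Exec (drain k p) ⟨v, S, o⟩ z (s + t + 2) :=
  exec_readWhile_step hS rfl h₁ h₂

theorem exec_moveAll {i j : W} (hij : i ≠ j) (v : CuckooMem) (S : W → List (Option Bool))
    (o : List B) :
    Exec (moveAll i j) ⟨v, S, o⟩ ⟨{ v with buf := none },
      Function.update (Function.update S i []) j ((S i).reverse ++ S j), o⟩
      (3 * (S i).length + 2) := by
  generalize hl : S i = l
  induction l generalizing v S with
  | nil =>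
    have h' : Function.update (Function.update S i []) j (([] : List (Option Bool)).reverse ++ S j)
        = S := by
      rw [← hl, Function.update_eq_self]
      simp [hl]
    rw [h']
    exact exec_drain_nil hl
  | cons a l ih =>
    have h := ih { v with buf := some a } (Function.update (Function.update S i l) j (a :: S j))
      (by simp [hij])
    refine (exec_drain_cons hl (Exec.congr (exec_unread j _ _ o) ?_ le_rfl) h).congr ?_
      (by simp only [List.length_cons]; omega)
    · simp [hij.symm]
    · congr 1
      funext k
      by_cases h₁ : k = i <;> by_cases h₂ : k = j <;> simp_all

theorem exec_clear (i : W) (v : CuckooMem) (S : W → List (Option Bool)) (o : List B) :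
    Exec (clear i) ⟨v, S, o⟩ ⟨{ v with buf := none }, Function.update S i [], o⟩
      (3 * (S i).length + 2) := by
  generalize hl : S i = l
  induction l generalizing v S with
  | nil =>
    rw [← hl, Function.update_eq_self]
    exact (exec_drain_nil hl).mono (by omega)
  | cons a l ih =>
    have h := ih { v with buf := some a } (Function.update S i l) (by simp)
    refine (exec_drain_cons hl (exec_skip _) h).congr ?_ (by simp only [List.length_cons]; omega)
    simp

theorem exec_readWord {i j k : W} (hij : i ≠ j) (hik : i ≠ k) (hjk : j ≠ k) (v : CuckooMem)
    (S : W → List (Option Bool)) (o : List B) {u r : List (Option Bool)} (hu : none ∉ u)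
    (hS : S i = u ++ none :: r) :
    Exec (readWord i j k) ⟨v, S, o⟩ ⟨{ v with buf := none },
      Function.update (Function.update (Function.update S i r) j (none :: (u.reverse ++ S j))) k
        (u.reverse ++ S k), o⟩ (4 * u.length + 4) := by
  have key : Exec (readWhile (fun a => a.any Option.isSome) i (.seq (unread j) (unread k)))
      ⟨v, S, o⟩ ⟨{ v with buf := some none },
      Function.update (Function.update (Function.update S i r) j (u.reverse ++ S j)) k
        (u.reverse ++ S k), o⟩ (4 * u.length + 2) := by
    induction u generalizing v S with
    | nil =>
      have h := exec_readWhile_exit (c := fun a => a.any Option.isSome) (k := i)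
        (p := .seq (unread j) (unread k)) (v := v) (S := S) (o := o) (by simp [hS])
      refine h.congr ?_ (by simp)
      rw [hS]
      congr 1
      funext l
      by_cases h₁ : l = i <;> by_cases h₂ : l = j <;> by_cases h₃ : l = k <;>
        simp_all [Function.update_apply]
    | cons a u ih =>
      simp only [List.mem_cons, not_or] at hu
      have ha : a.isSome := by
        cases a with
        | none => simp at hu
        | some a => rfl
      have h := ih { v with buf := some a } (Function.update (Function.update
        (Function.update S i (u ++ none :: r)) j (a :: S j)) k (a :: S k)) hu.2 (by simp [hij, hik])
      refine (exec_readWhile_step hS ha ((exec_unread j _ _ o).seq (exec_unread k _ _ o))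
        (Exec.congr_left ?_ h)).congr ?_ ?_
      · congr 1
        funext l
        by_cases h₁ : l = i <;> by_cases h₂ : l = j <;> by_cases h₃ : l = k <;>
          simp_all [Function.update_apply]
      · congr 1
        funext l
        by_cases h₁ : l = i <;> by_cases h₂ : l = j <;> by_cases h₃ : l = k <;>
          simp_all [Function.update_apply]
      · simp only [List.length_cons]
        omega
  refine (key.seq ((exec_push j _ _ _ o).seq (exec_load _ _ _ o))).congr ?_ (by omega)
  congr 1
  funext l
  by_cases h₁ : l = i <;> by_cases h₂ : l = j <;> by_cases h₃ : l = k <;>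
    simp_all [Function.update_apply]

/-- The stacks are popped in parallel, so that the flag survives the first loop iff `S i` is a
prefix of `S j` (`key₁`), and the second loop iff nothing of `S j` is left (`key₂`). A prefix that
is at least as long is the whole word. The letters popped from `j` wait on `k` and are moved back.
The letter `b` left in `buf'` is irrelevant, since it is erased at the end. -/
theorem exec_eqTest {i j k : W} (hij : i ≠ j) (hik : i ≠ k) (hjk : j ≠ k) (v : CuckooMem)
    (S : W → List (Option Bool)) (o : List B) (hv : v.buf' = none) (hS : S k = []) :
    Exec (eqTest i j k) ⟨v, S, o⟩ ⟨{ v with buf := none, eq := decide (S i = S j) },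
      Function.update S i [], o⟩ (6 * (S i).length + 7 * (S j).length + 8) := by
  have hji := hij.symm
  have hki := hik.symm
  have hkj := hjk.symm
  have key₁ : ∀ (u : List (Option Bool)) (v : CuckooMem) (S : W → List (Option Bool)), S i = u →
      ∃ b, Exec (drain i (.seq (.pop j fun v a => { v with buf' := a })
        (.seq (.load fun v => { v with eq := v.eq && v.buf == v.buf' })
          (.ite (fun v => v.buf'.isSome) (.push k fun v => v.buf'.getD none) skip)))) ⟨v, S, o⟩
        ⟨{ v with buf := none, buf' := b, eq := v.eq && u.isPrefixOf (S j) },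
          Function.update (Function.update (Function.update S i []) j ((S j).drop u.length)) k
            (((S j).take u.length).reverse ++ S k), o⟩ (6 * u.length + 2) := by
    intro u
    induction u with
    | nil =>
      intro v S hu
      refine ⟨v.buf', (exec_drain_nil hu).congr ?_ (by simp)⟩
      congr 1
      · simp
      · funext l
        by_cases h₁ : l = i <;> by_cases h₂ : l = j <;> by_cases h₃ : l = k <;>
          simp_all [Function.update_apply]
    | cons a u ih =>
      intro v S hu
      cases hw : S j with
      | nil =>
        obtain ⟨b, h⟩ := ih { v with buf := some a, buf' := none, eq := false }
          (Function.update S i u) (by simp)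
        refine ⟨b, (exec_drain_cons hu (Exec.congr ((exec_pop j _ _ _ o).seq
          ((exec_load _ _ _ o).seq (Exec.ite_false ?_ (exec_skip _)))) ?_ le_rfl) h).congr ?_ ?_⟩
        · simp [hij.symm, hw]
        · congr 1
          · simp [hij.symm, hw]
          · funext l
            by_cases h₁ : l = i <;> by_cases h₂ : l = j <;> by_cases h₃ : l = k <;>
              simp_all [Function.update_apply]
        · congr 1
          · simp [List.isPrefixOf]
          · funext l
            by_cases h₁ : l = i <;> by_cases h₂ : l = j <;> by_cases h₃ : l = k <;>
              simp_all
        · simp only [List.length_cons]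
          omega
      | cons c w =>
        obtain ⟨b, h⟩ := ih { v with buf := some a, buf' := some c, eq := v.eq && a == c }
          (Function.update (Function.update (Function.update S i u) j w) k (c :: S k))
          (by simp [hij, hik])
        refine ⟨b, (exec_drain_cons hu (Exec.congr ((exec_pop j _ _ _ o).seq
          ((exec_load _ _ _ o).seq (Exec.ite_true ?_ (exec_push k _ _ _ o)))) ?_ le_rfl) h).congr
            ?_ ?_⟩
        · simp [hij.symm, hw]
        · congr 1
          · simp [hij.symm, hw]
          · funext l
            by_cases h₁ : l = i <;> by_cases h₂ : l = j <;> by_cases h₃ : l = k <;>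
              simp_all
        · congr 1
          · simp [List.isPrefixOf, hjk, Bool.and_assoc]
          · funext l
            by_cases h₁ : l = i <;> by_cases h₂ : l = j <;> by_cases h₃ : l = k <;>
              simp_all
        · simp only [List.length_cons]
          omega
  have key₂ : ∀ (w : List (Option Bool)) (v : CuckooMem) (S : W → List (Option Bool)), S j = w →
      Exec (drain j (.seq (.load fun v => { v with eq := false }) (unread k))) ⟨v, S, o⟩
        ⟨{ v with buf := none, eq := v.eq && w.isEmpty },
          Function.update (Function.update S j []) k (w.reverse ++ S k), o⟩
        (4 * w.length + 2) := by
    intro w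
    induction w with
    | nil =>
      intro v S hw
      refine (exec_drain_nil hw).congr ?_ (by simp)
      congr 1
      · simp
      · funext l
        by_cases h₂ : l = j <;> by_cases h₃ : l = k <;> simp_all [Function.update_apply]
    | cons a w ih =>
      intro v S hw
      have h := ih { v with buf := some a, eq := false }
        (Function.update (Function.update S j w) k (a :: S k)) (by simp [hjk])
      refine (exec_drain_cons hw (Exec.congr ((exec_load _ _ _ o).seq (exec_unread k _ _ o)) ?_
        le_rfl) h).congr ?_ ?_
      · simp [hjk.symm]
      · congr 1
        · simp
        · funext l
          by_cases h₂ : l = j <;> by_cases h₃ : l = k <;> simp_all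
      · simp only [List.length_cons]
        omega
  obtain ⟨b, h₁⟩ := key₁ (S i) { v with eq := true } S rfl
  have h₂ := key₂ ((S j).drop (S i).length)
    { v with buf := none, buf' := b, eq := true && (S i).isPrefixOf (S j) }
    (Function.update (Function.update
    (Function.update S i []) j ((S j).drop (S i).length)) k
      (((S j).take (S i).length).reverse ++ S k)) (by simp [hjk])
  refine ((exec_load _ v S o).seq (h₁.seq (h₂.seq ((exec_moveAll hjk.symm _ _ o).seq
    (exec_load _ _ _ o))))).congr ?_ ?_
  · congr 1
    · simp only [hv, CuckooMem.mk.injEq, true_and, and_true]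
      rw [Bool.eq_iff_iff]
      simp only [Bool.and_eq_true, List.isPrefixOf_iff_prefix, List.isEmpty_iff,
        List.drop_eq_nil_iff, decide_eq_true_eq]
      constructor
      · rintro ⟨⟨-, h⟩, h'⟩
        exact h.eq_of_length_le h'
      · intro h
        simp [h]
    · funext l
      by_cases h₁ : l = i <;> by_cases h₂ : l = j <;> by_cases h₃ : l = k <;>
        simp_all
  · simp [hS]
    omega

end StackProg

/-! ### Processing a single edge. -/

namespace StackProg

/-- The stacks of the cuckoo program, as a family. -/
def cuckooStacks (i p f g h t w z c : List (Option Bool)) : CuckooStack → List (Option Bool)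
  | .inp => i
  | .past => p
  | .todo => f
  | .seen => g
  | .here => h
  | .there => t
  | .goal => w
  | .tmp => z
  | .fuel => c

section

variable (i p f g h t w z c x : List (Option Bool))

@[simp] theorem cuckooStacks_inp : cuckooStacks i p f g h t w z c .inp = i := rfl
@[simp] theorem cuckooStacks_past : cuckooStacks i p f g h t w z c .past = p := rfl
@[simp] theorem cuckooStacks_todo : cuckooStacks i p f g h t w z c .todo = f := rfl
@[simp] theorem cuckooStacks_seen : cuckooStacks i p f g h t w z c .seen = g := rfl
@[simp] theorem cuckooStacks_here : cuckooStacks i p f g h t w z c .here = h := rfl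
@[simp] theorem cuckooStacks_there : cuckooStacks i p f g h t w z c .there = t := rfl
@[simp] theorem cuckooStacks_goal : cuckooStacks i p f g h t w z c .goal = w := rfl
@[simp] theorem cuckooStacks_tmp : cuckooStacks i p f g h t w z c .tmp = z := rfl
@[simp] theorem cuckooStacks_fuel : cuckooStacks i p f g h t w z c .fuel = c := rfl

@[simp] theorem update_inp : Function.update (cuckooStacks i p f g h t w z c) .inp x =
    cuckooStacks x p f g h t w z c := by
  funext k; cases k <;> rfl
@[simp] theorem update_past : Function.update (cuckooStacks i p f g h t w z c) .past x =
    cuckooStacks i x f g h t w z c := by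
  funext k; cases k <;> rfl
@[simp] theorem update_todo : Function.update (cuckooStacks i p f g h t w z c) .todo x =
    cuckooStacks i p x g h t w z c := by
  funext k; cases k <;> rfl
@[simp] theorem update_seen : Function.update (cuckooStacks i p f g h t w z c) .seen x =
    cuckooStacks i p f x h t w z c := by
  funext k; cases k <;> rfl
@[simp] theorem update_here : Function.update (cuckooStacks i p f g h t w z c) .here x =
    cuckooStacks i p f g x t w z c := by
  funext k; cases k <;> rfl
@[simp] theorem update_there : Function.update (cuckooStacks i p f g h t w z c) .there x =
    cuckooStacks i p f g h x w z c := by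
  funext k; cases k <;> rfl
@[simp] theorem update_goal : Function.update (cuckooStacks i p f g h t w z c) .goal x =
    cuckooStacks i p f g h t x z c := by
  funext k; cases k <;> rfl
@[simp] theorem update_tmp : Function.update (cuckooStacks i p f g h t w z c) .tmp x =
    cuckooStacks i p f g h t w x c := by
  funext k; cases k <;> rfl
@[simp] theorem update_fuel : Function.update (cuckooStacks i p f g h t w z c) .fuel x =
    cuckooStacks i p f g h t w z x := by
  funext k; cases k <;> rfl

end

/-- The memory between two passes. -/
def cuckooMem (found go ok : Bool) : CuckooMem :=
  ⟨none, none, false, false, false, found, go, ok⟩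

variable {B : Type}

/-- Programs of the cuckoo machine. -/
abbrev CuckooProg (B : Type) : Type := StackProg CuckooStack (Option Bool) B CuckooMem

/-- Kick out the edge whose current label has been found to be the label to be occupied. -/
def kick : CuckooProg B :=
  .seq (.load fun v => { v with found := true, cur := !v.cur, mov := true })
    -- Words arrive reversed on `here` and `there`. Moving twice keeps this orientation, so that
    -- `goal` can later be compared with `here`.
    (.seq (clear .goal) (.seq (moveAll .there .tmp) (moveAll .tmp .goal)))

/-- Read the labels of an edge, the current one to `here` and the other one to `there`. -/
def readEdge : CuckooProg B :=
  .ite (fun v => v.cur) (.seq (readWord .inp .past .here) (readWord .inp .past .there))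
    (.seq (readWord .inp .past .there) (readWord .inp .past .here))

/-- Compare the current label of an edge with the label that is being occupied. -/
def testEdge : CuckooProg B :=
  .ite (fun v => !v.mov && !v.found)
    (.seq (eqTest .here .goal .tmp) (.ite (fun v => v.eq) kick skip))
    (.load fun v => { v with mov := false })

/-- Store the flags of an edge. -/
def recordEdge : CuckooProg B :=
  .seq (clear .here) (.seq (clear .there) (.seq (.push .seen fun v => some v.cur)
    (.seq (.push .seen fun v => some v.mov) (.load fun v => cuckooMem v.found v.go v.ok))))

/-- Process an edge after its first flag has been read. -/
def visitEdge : CuckooProg B :=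
  .seq (.load fun v => { v with cur := v.buf == some (some true) })
    (.seq (.pop .todo fun v a => { v with mov := a == some (some true) })
      (.seq readEdge (.seq testEdge recordEdge)))

theorem exec_readEdge {a b : List (Option Bool)} (ha : none ∉ a) (hb : none ∉ b) (v : CuckooMem)
    (r p f g w c : List (Option Bool)) (o : List B) :
    Exec readEdge ⟨v, cuckooStacks (a ++ none :: (b ++ none :: r)) p f g [] [] w [] c, o⟩
      ⟨{ v with buf := none }, cuckooStacks r (none :: (b.reverse ++ none :: (a.reverse ++ p))) f g
        (bif v.cur then a else b).reverse (bif v.cur then b else a).reverse w [] c, o⟩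
      (4 * a.length + 4 * b.length + 9) := by
  cases hv : v.cur with
  | true =>
    have h₁ := exec_readWord (i := .inp) (j := .past) (k := .here) (by decide) (by decide)
      (by decide) v (cuckooStacks (a ++ none :: (b ++ none :: r)) p f g [] [] w [] c) o ha rfl
    have h₂ := exec_readWord (i := .inp) (j := .past) (k := .there) (by decide) (by decide)
      (by decide) { v with buf := none } (cuckooStacks (b ++ none :: r)
        (none :: (a.reverse ++ p)) f g a.reverse [] w [] c) o hb rfl
    simp only [cuckooStacks_past, cuckooStacks_here, cuckooStacks_there, update_inp, update_past,
      update_here, update_there, List.append_nil] at h₁ h₂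
    exact (Exec.ite_true hv (h₁.seq h₂)).congr (by simp [hv]) (by omega)
  | false =>
    have h₁ := exec_readWord (i := .inp) (j := .past) (k := .there) (by decide) (by decide)
      (by decide) v (cuckooStacks (a ++ none :: (b ++ none :: r)) p f g [] [] w [] c) o ha rfl
    have h₂ := exec_readWord (i := .inp) (j := .past) (k := .here) (by decide) (by decide)
      (by decide) { v with buf := none } (cuckooStacks (b ++ none :: r)
        (none :: (a.reverse ++ p)) f g [] a.reverse w [] c) o hb rfl
    simp only [cuckooStacks_past, cuckooStacks_here, cuckooStacks_there, update_inp, update_past,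
      update_here, update_there, List.append_nil] at h₁ h₂
    exact (Exec.ite_false hv (h₁.seq h₂)).congr (by simp [hv]) (by omega)

theorem exec_recordEdge (v : CuckooMem) (i p g a b w c : List (Option Bool))
    (f : List (Option Bool)) (o : List B) :
    Exec recordEdge ⟨v, cuckooStacks i p f g a b w [] c, o⟩
      ⟨cuckooMem v.found v.go v.ok,
        cuckooStacks i p f (some v.mov :: some v.cur :: g) [] [] w [] c, o⟩
      (3 * a.length + 3 * b.length + 7) := by
  have h₁ := exec_clear .here v (cuckooStacks i p f g a b w [] c) o
  have h₂ := exec_clear .there { v with buf := none } (cuckooStacks i p f g [] b w [] c) o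
  simp only [cuckooStacks_here, cuckooStacks_there, update_here, update_there] at h₁ h₂
  refine (h₁.seq (h₂.seq ((exec_push _ _ _ _ _).seq ((exec_push _ _ _ _ _).seq
    (exec_load _ _ _ _))))).congr ?_ (by omega)
  simp

/-- An edge stays where it is for one of three reasons: it moved last and would only meet its own
label, another edge has been kicked out in this pass, or its label is not the one wanted. -/
theorem exec_keep_recordEdge {v : CuckooMem} (hb' : v.buf' = none)
    (i p f g a b w c : List (Option Bool)) (o : List B)
    (h : v.mov = true ∨ v.found = true ∨ a ≠ w) :
    Exec (.seq testEdge recordEdge) ⟨v, cuckooStacks i p f g a b w [] c, o⟩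
      ⟨cuckooMem v.found v.go v.ok,
        cuckooStacks i p f (some false :: some v.cur :: g) [] [] w [] c, o⟩
      (9 * a.length + 3 * b.length + 7 * w.length + 18) := by
  by_cases hv : (!v.mov && !v.found) = true
  · have haw : a ≠ w := by
      rcases h with h | h | h
      · simp [h] at hv
      · simp [h] at hv
      · exact h
    have h₁ := exec_eqTest (i := .here) (j := .goal) (k := .tmp) (by decide) (by decide)
      (by decide) v (cuckooStacks i p f g a b w [] c) o hb' rfl
    simp only [cuckooStacks_here, cuckooStacks_goal, update_here, haw, decide_false] at h₁
    have h₂ : Exec testEdge _ _ _ := Exec.ite_true hv (h₁.seq (Exec.ite_false (p := kick) rfl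
      (exec_skip _)))
    refine (h₂.seq (exec_recordEdge _ _ _ _ _ _ _ _ _ _)).congr ?_ ?_
    · have : v.mov = false := by simp at hv; exact hv.1
      simp [this]
    · simp only [List.length_nil]
      omega
  · have h₂ : Exec testEdge ⟨v, cuckooStacks i p f g a b w [] c, o⟩ _ _ :=
      Exec.ite_false (by simpa using hv) (exec_load _ _ _ _)
    exact (h₂.seq (exec_recordEdge _ _ _ _ _ _ _ _ _ _)).congr rfl (by omega)

theorem exec_kick_recordEdge {v : CuckooMem} (hb' : v.buf' = none) (hm : v.mov = false)
    (hf : v.found = false) (i p f g a b c : List (Option Bool)) (o : List B) :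
    Exec (.seq testEdge recordEdge) ⟨v, cuckooStacks i p f g a b a [] c, o⟩
      ⟨cuckooMem true v.go v.ok,
        cuckooStacks i p f (some true :: some (!v.cur) :: g) [] [] b [] c, o⟩
      (16 * a.length + 6 * b.length + 26) := by
  have h₁ := exec_eqTest (i := .here) (j := .goal) (k := .tmp) (by decide) (by decide)
    (by decide) v (cuckooStacks i p f g a b a [] c) o hb' rfl
  have h₃ := exec_clear .goal
    { v with buf := none, eq := true, found := true, cur := !v.cur, mov := true }
    (cuckooStacks i p f g [] b a [] c) o
  have h₄ := exec_moveAll (i := .there) (j := .tmp) (by decide)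
    { v with buf := none, eq := true, found := true, cur := !v.cur, mov := true }
    (cuckooStacks i p f g [] b [] [] c) o
  have h₅ := exec_moveAll (i := .tmp) (j := .goal) (by decide)
    { v with buf := none, eq := true, found := true, cur := !v.cur, mov := true }
    (cuckooStacks i p f g [] [] [] b.reverse c) o
  simp only [cuckooStacks_here, cuckooStacks_goal, cuckooStacks_there, cuckooStacks_tmp,
    update_here, update_goal, update_there, update_tmp, decide_true, List.append_nil,
    List.reverse_reverse, List.length_reverse] at h₁ h₃ h₄ h₅
  have h₂ : Exec testEdge _ _ _ := Exec.ite_true (by simp [hm, hf]) (h₁.seq (Exec.ite_true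
    (q := skip) rfl ((exec_load _ _ _ _).seq (h₃.seq (h₄.seq h₅)))))
  refine (h₂.seq (exec_recordEdge _ _ _ _ _ _ _ _ _ _)).congr rfl ?_
  simp only [List.length_nil]
  omega

theorem exec_visitEdge_keep {a b : List (Option Bool)} (ha : none ∉ a) (hb : none ∉ b)
    (cur mov found go ok : Bool) {N : ℕ} (r p f g w c : List (Option Bool)) (o : List B)
    (h : mov = true ∨ found = true ∨ (bif cur then a else b).reverse ≠ w)
    (hN : a.length ≤ N) (hN' : b.length ≤ N) (hw : w.length ≤ N) :
    Exec visitEdge ⟨{ cuckooMem found go ok with buf := some (some cur) },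
        cuckooStacks (a ++ none :: (b ++ none :: r)) p (some mov :: f) g [] [] w [] c, o⟩
      ⟨cuckooMem found go ok, cuckooStacks r (none :: (b.reverse ++ none :: (a.reverse ++ p))) f
        (some false :: some cur :: g) [] [] w [] c, o⟩ (30 * N + 40) := by
  have h₁ := exec_readEdge ha hb ⟨some (some cur), none, false, cur, mov, found, go, ok⟩ r p f
    g w c o
  have h₂ := exec_keep_recordEdge (v := ⟨none, none, false, cur, mov, found, go, ok⟩) rfl r
    (none :: (b.reverse ++ none :: (a.reverse ++ p))) f g (bif cur then a else b).reverse
    (bif cur then b else a).reverse w c o h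
  refine ((exec_load _ _ _ _).seq ((exec_pop _ _ _ _ _).seq
    (Exec.seq (Exec.congr_left ?_ h₁) h₂))).congr rfl ?_
  · cases cur <;> cases mov <;> simp [cuckooMem]
  · cases cur <;> simp <;> omega

theorem exec_visitEdge_kick {a b : List (Option Bool)} (ha : none ∉ a) (hb : none ∉ b)
    (cur go ok : Bool) {N : ℕ} (r p f g c : List (Option Bool)) (o : List B)
    (hN : a.length ≤ N) (hN' : b.length ≤ N) :
    Exec visitEdge ⟨{ cuckooMem false go ok with buf := some (some cur) },
        cuckooStacks (a ++ none :: (b ++ none :: r)) p (some false :: f) g [] []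
          (bif cur then a else b).reverse [] c, o⟩
      ⟨cuckooMem true go ok, cuckooStacks r (none :: (b.reverse ++ none :: (a.reverse ++ p))) f
        (some true :: some (!cur) :: g) [] [] (bif cur then b else a).reverse [] c, o⟩
      (30 * N + 40) := by
  have h₁ := exec_readEdge ha hb ⟨some (some cur), none, false, cur, false, false, go, ok⟩ r p f g
    (bif cur then a else b).reverse c o
  have h₂ := exec_kick_recordEdge (v := ⟨none, none, false, cur, false, false, go, ok⟩) rfl rfl rfl
    r (none :: (b.reverse ++ none :: (a.reverse ++ p))) f g (bif cur then a else b).reverse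
    (bif cur then b else a).reverse c o
  refine ((exec_load _ _ _ _).seq ((exec_pop _ _ _ _ _).seq
    (Exec.seq (Exec.congr_left ?_ h₁) h₂))).congr rfl ?_
  · cases cur <;> simp [cuckooMem]
  · cases cur <;> simp <;> omega

/-! ### Passes over the inserted edges, and the control between passes. -/

section Scan

variable {ι : Type} {lab : ι → Bool → List (Option Bool)} {cur mov : ι → Bool}

/-- The code of the two labels of an edge. -/
def edgeCode (lab : ι → Bool → List (Option Bool)) (i : ι) : List (Option Bool) :=
  lab i true ++ none :: (lab i false ++ [none])

/-- The code of the flags of an edge. -/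
def flagCode (cur mov : ι → Bool) (i : ι) : List (Option Bool) :=
  [some (cur i), some (mov i)]

/-- One pass over all the edges that have been inserted. -/
def scan : CuckooProg B := drain .todo visitEdge

/-- The remaining execution up to `z` is a hypothesis, so that segments of a pass can be chained, in
particular around a kick. -/
theorem exec_scan_keep {l : List ι} (hlab : ∀ i ∈ l, ∀ b, none ∉ lab i b) {N : ℕ}
    (hN : ∀ i ∈ l, ∀ b, (lab i b).length ≤ N) {found go ok : Bool}
    {r f w c : List (Option Bool)} {o : List B} (hw : w.length ≤ N)
    (h : ∀ i ∈ l, mov i = true ∨ found = true ∨ (lab i (cur i)).reverse ≠ w)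
    {z : State CuckooStack (Option Bool) B CuckooMem} {t : ℕ} :
    ∀ {p g : List (Option Bool)}, Exec scan ⟨cuckooMem found go ok,
      cuckooStacks r ((l.flatMap (edgeCode lab)).reverse ++ p) f
      ((l.flatMap (flagCode cur fun _ => false)).reverse ++ g) [] [] w [] c, o⟩ z t →
    Exec scan ⟨cuckooMem found go ok, cuckooStacks (l.flatMap (edgeCode lab) ++ r) p
      (l.flatMap (flagCode cur mov) ++ f) g [] [] w [] c, o⟩ z (l.length * (30 * N + 42) + t) := by
  induction l with
  | nil =>
    intro p g hz
    simpa using hz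
  | cons i l ih =>
    intro p g hz
    simp only [List.mem_cons, forall_eq_or_imp] at hlab hN h
    have h₁ := exec_visitEdge_keep (hlab.1 true) (hlab.1 false) (cur i) (mov i) found go ok
      (l.flatMap (edgeCode lab) ++ r) p (l.flatMap (flagCode cur mov) ++ f) g w c o
      (by cases hc : cur i <;> simpa [hc] using h.1) (hN.1 true) (hN.1 false) hw
    have h₂ := ih hlab.2 hN.2 h.2 (p := none :: ((lab i false).reverse ++ none ::
      ((lab i true).reverse ++ p))) (g := some false :: some (cur i) :: g)
      (by simpa [edgeCode, flagCode] using hz)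
    refine (exec_drain_cons (a := some (cur i))
      (l := some (mov i) :: (l.flatMap (flagCode cur mov) ++ f)) ?_
      (Exec.congr_left ?_ h₁) h₂).mono ?_
    · simp [flagCode]
    · simp [edgeCode, cuckooMem]
    · simp only [List.length_cons]
      ring_nf
      omega

/-- The state after a pass over the edges `l`, with the edges `r` not yet inserted. -/
def headState (lab : ι → Bool → List (Option Bool)) (found go ok : Bool) (l r : List ι)
    (cur mov : ι → Bool) (w : List (Option Bool)) (c : ℕ) (o : List B) :
    State CuckooStack (Option Bool) B CuckooMem :=
  ⟨cuckooMem found go ok, cuckooStacks (r.flatMap (edgeCode lab)) (l.flatMap (edgeCode lab)).reverse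
    [] (l.flatMap (flagCode cur mov)).reverse [] [] w [] (List.replicate c none), o⟩

/-- The state before a pass over the edges `l`, with the edges `r` not yet inserted. -/
def startState (lab : ι → Bool → List (Option Bool)) (l r : List ι)
    (cur mov : ι → Bool) (w : List (Option Bool)) (c : ℕ) (o : List B) :
    State CuckooStack (Option Bool) B CuckooMem :=
  ⟨cuckooMem false true false, cuckooStacks ((l ++ r).flatMap (edgeCode lab)) []
    (l.flatMap (flagCode cur mov)) [] [] [] w [] (List.replicate c none), o⟩

theorem exec_scan_nil (v : CuckooMem) (i p g h t w z c : List (Option Bool)) (o : List B) :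
    Exec scan ⟨v, cuckooStacks i p [] g h t w z c, o⟩
      ⟨{ v with buf := none }, cuckooStacks i p [] g h t w z c, o⟩ 2 :=
  exec_drain_nil rfl

theorem exec_scan_none {l r : List ι} (hlab : ∀ i ∈ l, ∀ b, none ∉ lab i b) {N : ℕ}
    (hN : ∀ i ∈ l, ∀ b, (lab i b).length ≤ N) {w : List (Option Bool)} (hw : w.length ≤ N)
    (h : ∀ i ∈ l, mov i = true ∨ (lab i (cur i)).reverse ≠ w) (c : ℕ) (o : List B) :
    Exec scan (startState lab l r cur mov w c o)
      (headState lab false true false l r cur (fun _ => false) w c o)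
      (l.length * (30 * N + 42) + 2) := by
  have h₁ := exec_scan_keep (B := B) hlab hN (found := false) (go := true) (ok := false)
    (r := r.flatMap (edgeCode lab)) (f := []) (c := List.replicate c none) (o := o) (p := [])
    (g := []) (mov := mov) hw (by simpa using h) (exec_scan_nil _ _ _ _ _ _ _ _ _ _)
  simp only [List.append_nil, ← List.flatMap_append] at h₁
  exact h₁

/-- The pass is cut at `j`: no edge of `l₁` matches, `j` is kicked out, and from then on `found`
protects the edges of `l₂`. It is assembled from the back. -/
theorem exec_scan_kick [DecidableEq ι] {l₁ l₂ r : List ι} {j : ι}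
    (hlab : ∀ i ∈ l₁ ++ j :: l₂, ∀ b, none ∉ lab i b) {N : ℕ}
    (hN : ∀ i ∈ l₁ ++ j :: l₂, ∀ b, (lab i b).length ≤ N) (hnd : (l₁ ++ j :: l₂).Nodup)
    (h : ∀ i ∈ l₁, mov i = true ∨ lab i (cur i) ≠ lab j (cur j)) (hj : mov j = false)
    (c : ℕ) (o : List B) :
    Exec scan (startState lab (l₁ ++ j :: l₂) r cur mov (lab j (cur j)).reverse c o)
      (headState lab true true false (l₁ ++ j :: l₂) r (Function.update cur j (!cur j))
        (fun i => decide (i = j)) (lab j (!cur j)).reverse c o)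
      ((l₁ ++ j :: l₂).length * (30 * N + 42) + 2) := by
  have hnd' := List.nodup_append.1 hnd
  have hj₁ : j ∉ l₁ := fun hj => hnd'.2.2 j hj j (by simp) rfl
  have hj₂ : j ∉ l₂ := (List.nodup_cons.1 hnd'.2.1).1
  have hflag : ∀ l : List ι, j ∉ l → l.flatMap (flagCode (Function.update cur j (!cur j))
      fun i => decide (i = j)) = l.flatMap (flagCode cur fun _ => false) := by
    intro l hl
    refine List.flatMap_congr fun i hi => ?_
    have hij : i ≠ j := fun h => hl (h ▸ hi)
    simp [flagCode, hij]
  simp only [List.mem_append, List.mem_cons, or_imp, forall_and, forall_eq] at hlab hN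
  have h₃ := exec_scan_keep (B := B) hlab.2.2 hN.2.2 (found := true) (go := true) (ok := false)
    (r := r.flatMap (edgeCode lab)) (f := []) (c := List.replicate c none) (o := o)
    (p := none :: ((lab j false).reverse ++ none :: ((lab j true).reverse ++
      (l₁.flatMap (edgeCode lab)).reverse)))
    (g := some true :: some (!cur j) :: (l₁.flatMap (flagCode cur fun _ => false)).reverse)
    (cur := cur) (mov := mov) (w := (lab j (!cur j)).reverse) (by simpa using hN.2.1 _) (by simp)
    (exec_scan_nil _ _ _ _ _ _ _ _ _ _)
  have h₂ := exec_visitEdge_kick (B := B) (hlab.2.1 true) (hlab.2.1 false) (cur j) true false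
    (l₂.flatMap (edgeCode lab) ++ r.flatMap (edgeCode lab)) (l₁.flatMap (edgeCode lab)).reverse
    (l₂.flatMap (flagCode cur mov)) (l₁.flatMap (flagCode cur fun _ => false)).reverse
    (List.replicate c none) o (hN.2.1 true) (hN.2.1 false)
  have hc : (bif cur j then lab j true else lab j false) = lab j (cur j) := by
    cases cur j <;> rfl
  have hc' : (bif cur j then lab j false else lab j true) = lab j (!cur j) := by
    cases cur j <;> rfl
  rw [hc, hc'] at h₂
  simp only [List.append_nil] at h₃
  have h₄ := exec_scan_keep (B := B) hlab.1 hN.1 (found := false) (go := true) (ok := false)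
    (r := edgeCode lab j ++ (l₂.flatMap (edgeCode lab) ++ r.flatMap (edgeCode lab)))
    (f := flagCode cur mov j ++ l₂.flatMap (flagCode cur mov))
    (c := List.replicate c none) (o := o) (p := []) (g := []) (mov := mov)
    (w := (lab j (cur j)).reverse) (by simpa using hN.2.1 _) (by simpa using h)
    (exec_drain_cons (a := some (cur j)) (l := some (mov j) :: l₂.flatMap (flagCode cur mov)) rfl
      (Exec.congr_left (by simp [edgeCode, cuckooMem, hj]) h₂) h₃)
  refine (Exec.congr_left ?_ h₄).congr ?_ ?_
  · simp [startState]
  · simp [headState, hflag l₁ hj₁, hflag l₂ hj₂, edgeCode, flagCode, cuckooMem]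
  · simp only [List.length_append, List.length_cons]
    ring_nf
    omega

/-- Insert the next edge at its first label. -/
def insertEdge : CuckooProg B :=
  .seq (clear .goal) (.seq (readWord .inp .past .goal) (.seq (readWord .inp .past .there)
    -- The second label was read only to get past it. The flags say that the edge sits at its first
    -- label and is the one that moved last.
    (.seq (clear .there) (.seq (.push .seen fun _ => some true) (.push .seen fun _ => some true)))))

/-- Decide how to go on after a pass: if an edge has been kicked out, a unit of fuel is needed, and
otherwise the next edge is inserted. -/
def advance : CuckooProg B :=
  .ite (fun v => v.found)
    (.seq (read .fuel) (.ite (fun v => v.buf.isSome) (.load fun v => { v with buf := none })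
      (.load fun v => { v with go := false })))
    -- This letter only shows whether an edge is left; it is put back before the insertion.
    (.seq (read .inp) (.ite (fun v => v.buf.isSome) (.seq (unread .inp) insertEdge)
      (.load fun v => { v with go := false, ok := true })))

/-- Prepare the next pass, and fill in fuel if an edge has been inserted. -/
def rewind : CuckooProg B :=
  .seq (.ite (fun v => v.found) (moveAll .past .inp)
    -- One unit of fuel for each letter of the inserted edges, hence at least two for each edge.
    (drain .past (.seq (unread .inp) (.push .fuel fun _ => none))))
    (.seq (moveAll .seen .todo) (.load fun v => { v with found := false }))

/-- The main loop of cuckoo insertion. -/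
def insertAll : CuckooProg B :=
  .loop (fun v => v.go) (.seq advance (.ite (fun v => v.go) (.seq rewind scan) skip))

theorem exec_advance_fuel (l r : List ι) (w : List (Option Bool)) (c : ℕ) (o : List B) :
    Exec advance (headState lab true true false l r cur mov w (c + 1) o)
      (headState lab true true false l r cur mov w c o) 4 := by
  refine (Exec.ite_true rfl ((exec_pop _ _ _ _ _).seq (Exec.ite_true ?_ (exec_load _ _ _ _)))).congr
    ?_ le_rfl
  · simp [List.replicate_succ]
  · simp [headState, cuckooMem, List.replicate_succ]

theorem exec_advance_fail (l r : List ι) (w : List (Option Bool)) (o : List B) :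
    Exec advance (headState lab true true false l r cur mov w 0 o)
      (headState lab true false false l r cur mov w 0 o) 4 := by
  refine (Exec.ite_true rfl ((exec_pop _ _ _ _ _).seq (Exec.ite_false ?_
    (exec_load _ _ _ _)))).congr ?_ (by omega)
  · simp
  · simp [headState, cuckooMem]

theorem exec_advance_done (l : List ι) (w : List (Option Bool)) (c : ℕ) (o : List B) :
    Exec advance (headState lab false true false l [] cur mov w c o)
      (headState lab false false true l [] cur mov w c o) 4 := by
  refine (Exec.ite_false rfl ((exec_pop _ _ _ _ _).seq (Exec.ite_false ?_
    (exec_load _ _ _ _)))).congr ?_ (by omega)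
  · simp
  · simp [headState, cuckooMem]

theorem exec_advance_insert [DecidableEq ι] {i : ι} (hlab : ∀ b, none ∉ lab i b) {l : List ι}
    (hi : i ∉ l) {N : ℕ} (hN : ∀ b, (lab i b).length ≤ N) {w : List (Option Bool)}
    (hw : w.length ≤ N) (r : List ι) (c : ℕ) (o : List B) :
    Exec advance (headState lab false true false l (i :: r) cur (fun _ => false) w c o)
      (headState lab false true false (l ++ [i]) r (Function.update cur i true)
        (fun k => decide (k = i)) (lab i true).reverse c o) (14 * N + 19) := by
  have hflag : l.flatMap (flagCode (Function.update cur i true) fun k => decide (k = i)) =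
      l.flatMap (flagCode cur fun _ => false) := by
    refine List.flatMap_congr fun k hk => ?_
    have hki : k ≠ i := fun h => hi (h ▸ hk)
    simp [flagCode, hki]
  -- The word of a label may be empty, but the separators ensure that there is a letter to read.
  obtain ⟨a, x, hx⟩ : ∃ a x, (i :: r).flatMap (edgeCode lab) = a :: x := by
    cases h : lab i true <;> simp [edgeCode, h]
  have hx' : a :: x = lab i true ++ none :: (lab i false ++ none :: r.flatMap (edgeCode lab)) := by
    rw [← hx]
    simp [edgeCode]
  set p := (l.flatMap (edgeCode lab)).reverse with hp
  set g := (l.flatMap (flagCode cur fun _ => false)).reverse with hg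
  set c' : List (Option Bool) := List.replicate c none with hc'
  set v : CuckooMem := { cuckooMem false true false with buf := some a } with hv
  have h₁ := exec_clear (B := B) .goal v (cuckooStacks (a :: x) p [] g [] [] w [] c') o
  have h₂ := exec_readWord (B := B) (i := .inp) (j := .past) (k := .goal) (by decide) (by decide)
    (by decide) { v with buf := none } (cuckooStacks (a :: x) p [] g [] [] [] [] c') o
    (r := lab i false ++ none :: r.flatMap (edgeCode lab)) (hlab true) hx'
  have h₃ := exec_readWord (B := B) (i := .inp) (j := .past) (k := .there) (by decide) (by decide)
    (by decide) { v with buf := none } (cuckooStacks (lab i false ++ none :: r.flatMap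
      (edgeCode lab)) (none :: ((lab i true).reverse ++ p)) [] g [] [] (lab i true).reverse [] c') o
      (hlab false) rfl
  have h₄ := exec_clear (B := B) .there { v with buf := none }
    (cuckooStacks (r.flatMap (edgeCode lab)) (none :: ((lab i false).reverse ++
      (none :: ((lab i true).reverse ++ p)))) [] g [] (lab i false).reverse (lab i true).reverse
        [] c') o
  simp only [cuckooStacks_goal, cuckooStacks_past, cuckooStacks_there, update_goal, update_inp,
    update_past, update_there, List.append_nil] at h₁ h₂ h₃ h₄
  have h₅ : Exec insertEdge _ _ _ := h₁.seq (h₂.seq (h₃.seq (h₄.seq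
    ((exec_push CuckooStack.seen (fun _ => some true) _ _ _).seq
      (exec_push CuckooStack.seen (fun _ => some true) _ _ _)))))
  refine (Exec.ite_false rfl ((exec_pop _ _ _ _ _).seq (Exec.ite_true ?_
    (Exec.seq (Exec.congr (exec_unread _ _ _ _) ?_ le_rfl) h₅)))).congr ?_ ?_
  · simp [hx]
  · simp [hx, hv, hp, hg, hc']
  · simp [headState, hv, hp, hg, hc', cuckooMem, hflag, edgeCode, flagCode]
  · have h₆ := hN true
    have h₇ := hN false
    rw [List.length_reverse]
    omega

theorem exec_refuel (v : CuckooMem) (i p f g h t w z c : List (Option Bool)) (o : List B) :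
    Exec (drain .past (.seq (unread .inp) (.push .fuel fun _ => none)))
      ⟨v, cuckooStacks i p f g h t w z c, o⟩
      ⟨{ v with buf := none }, cuckooStacks (p.reverse ++ i) [] f g h t w z
        (List.replicate p.length none ++ c), o⟩ (4 * p.length + 2) := by
  induction p generalizing v i c with
  | nil => exact exec_drain_nil rfl
  | cons a p ih =>
    have h := ih { v with buf := some a } (a :: i) (none :: c)
    refine (exec_drain_cons (k := CuckooStack.past) (a := a) (l := p) rfl
      (Exec.congr ((exec_unread _ _ _ _).seq (exec_push _ _ _ _ _)) ?_ le_rfl) h).congr ?_ ?_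
    · simp
    · simp only [List.reverse_cons, List.append_assoc, List.singleton_append, List.length_cons,
        List.replicate_succ']
    · simp only [List.length_cons]
      omega

/-- Each edge contributes two separators. This is why the fuel covers the bound of `potential_le`.
-/
theorem two_mul_length_le (lab : ι → Bool → List (Option Bool)) (l : List ι) :
    2 * l.length ≤ (l.flatMap (edgeCode lab)).length := by
  induction l with
  | nil => simp
  | cons i l ih =>
    simp only [List.flatMap_cons, List.length_append, List.length_cons, edgeCode]
    omega

theorem length_flatMap_flagCode (l : List ι) :
    (l.flatMap (flagCode cur mov)).length = 2 * l.length := by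
  simp [flagCode, mul_comm]

theorem exec_rewind (found : Bool) (l r : List ι) (w : List (Option Bool)) (c : ℕ) (o : List B) :
    Exec rewind (headState lab found true false l r cur mov w c o)
      (startState lab l r cur mov w
        (bif found then c else c + (l.flatMap (edgeCode lab)).length) o)
      (7 * (l.flatMap (edgeCode lab)).length + 6) := by
  have hl := two_mul_length_le lab l
  set p := (l.flatMap (edgeCode lab)).reverse with hp
  have hp' : p.length = (l.flatMap (edgeCode lab)).length := by simp [hp]
  have h₂ : ∀ i c, Exec (moveAll .seen .todo) ⟨cuckooMem found true false, cuckooStacks i [] []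
      (l.flatMap (flagCode cur mov)).reverse [] [] w [] c, o⟩ ⟨cuckooMem found true false,
      cuckooStacks i [] (l.flatMap (flagCode cur mov)) [] [] [] w [] c, o⟩ (6 * l.length + 2) := by
    intro i c
    refine (exec_moveAll (by decide) _ _ o).congr ?_ ?_
    · simp [cuckooMem]
    · simp only [cuckooStacks_seen, List.length_reverse, length_flatMap_flagCode]
      omega
  cases found with
  | true =>
    refine ((Exec.ite_true rfl (exec_moveAll (by decide) _ _ o)).seq ((Exec.congr_left ?_
      (h₂ ((l ++ r).flatMap (edgeCode lab)) (List.replicate c none))).seq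
        (exec_load _ _ _ _))).congr ?_ ?_
    · simp [cuckooMem]
    · simp [startState, cuckooMem]
    · simp only [cuckooStacks_past, ← hp, hp']
      omega
  | false =>
    have hc : List.replicate (c + (l.flatMap (edgeCode lab)).length) (none : Option Bool) =
        List.replicate p.length none ++ List.replicate c none := by
      rw [List.replicate_append_replicate, hp', add_comm]
    refine ((Exec.ite_false rfl (exec_refuel _ _ _ _ _ _ _ _ _ _ o)).seq ((Exec.congr_left ?_
      (h₂ ((l ++ r).flatMap (edgeCode lab))
        (List.replicate p.length none ++ List.replicate c none))).seq
        (exec_load _ _ _ _))).congr ?_ ?_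
    · rw [List.flatMap_append, ← hp, show l.flatMap (edgeCode lab) = p.reverse by simp [hp]]
      rfl
    · rw [startState, cond_false, hc]
      rfl
    · simp only [← hp, hp']
      omega

end Scan

end StackProg

/-! ### The combinatorics of kicks. -/

namespace CuckooInsertion

variable {ι α : Type*} [DecidableEq ι] {lab : ι → Bool → α} {l : Finset ι}
  {cur f : ι → Bool} {e j : ι}

/-- The number of edges different from `e` to which `cur` and `f` assign the same label. -/
def agreement [DecidableEq α] (lab : ι → Bool → α) (l : Finset ι) (cur : ι → Bool)
    (e : ι) (f : ι → Bool) : ℕ :=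
  -- Labels are compared rather than ends, so an edge with two equal labels needs no separate
  -- treatment.
  {i ∈ l | i ≠ e ∧ lab i (cur i) = lab i (f i)}.card

/-- A bound on the number of kicks that follow the insertion of `e`, if `f` is a solution. -/
def potential [DecidableEq α] (lab : ι → Bool → α) (l : Finset ι) (cur : ι → Bool)
    (e : ι) (f : ι → Bool) : ℕ :=
  -- Once `e` is correct, each further kick corrects another edge. While `e` is wrong, each kick
  -- spoils a correct edge, until some edge lands correctly and at most `l.card` remains to be paid.
  if lab e (cur e) = lab e (f e) then l.card - agreement lab l cur e f
  else l.card + 1 + agreement lab l cur e f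

/-- The edges different from `e` occupy different labels. -/
def IsPlaced (lab : ι → Bool → α) (l : Finset ι) (cur : ι → Bool) (e : ι) : Prop :=
  Set.InjOn (fun i => lab i (cur i)) {i | i ∈ l ∧ i ≠ e}

theorem agreement_lt_card [DecidableEq α] (he : e ∈ l) : agreement lab l cur e f < l.card := by
  refine Finset.card_lt_card (Finset.ssubset_iff_subset_ne.2 ⟨Finset.filter_subset _ _, ?_⟩)
  intro h
  have := h ▸ he
  simp at this

theorem potential_le [DecidableEq α] (he : e ∈ l) : potential lab l cur e f ≤ 2 * l.card := by
  have := agreement_lt_card (lab := lab) (cur := cur) (f := f) he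
  unfold potential
  split_ifs <;> omega

theorem potential_kick_lt [DecidableEq α] (hf : Set.InjOn (fun i => lab i (f i)) l)
    (he : e ∈ l) (hj : j ∈ l)
    (hje : j ≠ e) (hlab : lab j (cur j) = lab e (cur e)) :
    potential lab l (Function.update cur j (!cur j)) j f < potential lab l cur e f := by
  have hlt := agreement_lt_card (lab := lab) (cur := cur) (f := f) he
  by_cases hr : lab e (cur e) = lab e (f e)
  · have hne : lab j (cur j) ≠ lab j (f j) := fun h =>
      hje (hf hj he (h.symm.trans (hlab.trans hr)))
    have hfj : f j = !cur j := by
      cases h₁ : f j <;> cases h₂ : cur j <;> simp_all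
    have hagr : agreement lab l cur e f <
        agreement lab l (Function.update cur j (!cur j)) j f := by
      refine Finset.card_lt_card ((Finset.ssubset_iff_of_subset ?_).2 ⟨e, ?_, ?_⟩)
      · intro i hi
        simp only [Finset.mem_filter] at hi ⊢
        have hij : i ≠ j := by
          rintro rfl
          exact hne hi.2.2
        simp [hi, hij]
      · simp [he, hje.symm, hr]
      · simp
    have h' : lab j (Function.update cur j (!cur j) j) = lab j (f j) := by
      simp [hfj]
    simp only [potential, if_pos hr, if_pos h']
    omega
  · simp only [potential, if_neg hr]
    split_ifs with h'
    · omega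
    -- Since `j` lands at a wrong label, it was correct before. It leaves the count, and `e`, which
    -- enters the comparison, is wrong.
    · have hfj : f j = cur j := by
        rw [Function.update_self] at h'
        cases h₁ : f j <;> cases h₂ : cur j <;> simp_all
      have hagr : agreement lab l (Function.update cur j (!cur j)) j f <
          agreement lab l cur e f := by
        refine Finset.card_lt_card ((Finset.ssubset_iff_of_subset ?_).2 ⟨j, ?_, ?_⟩)
        · intro i hi
          simp only [Finset.mem_filter] at hi ⊢
          have hij := hi.2.1
          have hi' := hi.2.2
          rw [Function.update_of_ne hij] at hi'
          refine ⟨hi.1, ?_, hi'⟩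
          rintro rfl
          exact hr hi'
        · simp [hj, hje, hfj]
        · simp
      omega

/-- The edge `e` takes over the label of `j`, which no third edge had, and `j` becomes the exempt
edge. -/
theorem IsPlaced.kick (h : IsPlaced lab l cur e) (hj : j ∈ l) (hje : j ≠ e)
    (hlab : lab j (cur j) = lab e (cur e)) :
    IsPlaced lab l (Function.update cur j (!cur j)) j := by
  rintro i ⟨hi, hij⟩ k ⟨hk, hkj⟩ hik
  simp only [Function.update_of_ne hij, Function.update_of_ne hkj] at hik
  by_cases hie : i = e <;> by_cases hke : k = e
  · exact hie.trans hke.symm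
  · subst hie
    exact absurd (h ⟨hk, hke⟩ ⟨hj, hje⟩ (hik.symm.trans hlab.symm)) hkj
  · subst hke
    exact absurd (h ⟨hi, hie⟩ ⟨hj, hje⟩ (hik.trans hlab.symm)) hij
  · exact h ⟨hi, hie⟩ ⟨hk, hke⟩ hik

theorem IsPlaced.injOn (h : IsPlaced lab l cur e)
    (hne : ∀ j ∈ l, j ≠ e → lab j (cur j) ≠ lab e (cur e)) :
    Set.InjOn (fun i => lab i (cur i)) l := by
  intro i hi k hk hik
  by_cases hie : i = e <;> by_cases hke : k = e
  · exact hie.trans hke.symm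
  · subst hie
    exact absurd hik.symm (hne k hk hke)
  · subst hke
    exact absurd hik (hne i hi hie)
  · exact h ⟨hi, hie⟩ ⟨hk, hke⟩ hik

theorem isPlaced_insert (h : Set.InjOn (fun i => lab i (cur i)) l) (b : Bool) :
    IsPlaced lab (insert e l) (Function.update cur e b) e := by
  rintro i ⟨hi, hie⟩ k ⟨hk, hke⟩ hik
  simp only [Function.update_of_ne hie, Function.update_of_ne hke] at hik
  exact h (Finset.mem_of_mem_insert_of_ne hi hie) (Finset.mem_of_mem_insert_of_ne hk hke) hik

end CuckooInsertion

/-! ### Correctness and running time of the main loop. -/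

namespace StackProg

open CuckooInsertion

variable {B ι : Type} {lab : ι → Bool → List (Option Bool)} {L l r : List ι} {Q c : ℕ} {o : List B}

/-- The states in which the main loop can stop. -/
def IsFinal (lab : ι → Bool → List (Option Bool)) (Q n : ℕ) (L : List ι) (o : List B)
    (x : State CuckooStack (Option Bool) B CuckooMem) : Prop :=
  ∃ found ok l r cur mov w c, x = headState lab found false ok l r cur mov w c o ∧ l ++ r = L ∧
    -- These two bounds limit the time for emptying the stacks afterwards.
    w.length ≤ Q ∧ c ≤ n ∧
    (ok = true → r = [] ∧ Set.InjOn (fun i => lab i (cur i)) {i | i ∈ L}) ∧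
    (ok = false → ¬ ∃ f : ι → Bool, Set.InjOn (fun i => lab i (f i)) {i | i ∈ L})

theorem IsFinal.mono {n m : ℕ} {x : State CuckooStack (Option Bool) B CuckooMem}
    (h : IsFinal lab Q n L o x) (hnm : n ≤ m) : IsFinal lab Q m L o x := by
  obtain ⟨found, ok, l, r, cur, mov, w, c, h₁, h₂, h₃, h₄, h₅⟩ := h
  exact ⟨found, ok, l, r, cur, mov, w, c, h₁, h₂, h₃, h₄.trans hnm, h₅⟩

variable [DecidableEq ι]

/-- The states of the main loop after a pass: either an edge has been kicked out and there is fuel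
for all the kicks that can follow if there is a solution, or all the edges `l` have been placed. -/
def IsHead (lab : ι → Bool → List (Option Bool)) (Q : ℕ) (l r : List ι) (c : ℕ) (o : List B)
    (x : State CuckooStack (Option Bool) B CuckooMem) : Prop :=
  (∃ cur, ∃ e ∈ l, IsPlaced lab l.toFinset cur e ∧
    -- The strict inequality leaves a unit for the kick just made. With `c = 0` it is absurd for
    -- every solution, so running out of fuel proves that there is none.
    (∀ f : ι → Bool, Set.InjOn (fun i => lab i (f i)) {i | i ∈ l ++ r} →
      potential lab l.toFinset cur e f < c) ∧
    x = headState lab true true false l r cur (fun i => decide (i = e))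
      (lab e (cur e)).reverse c o) ∨
  ∃ cur w, Set.InjOn (fun i => lab i (cur i)) {i | i ∈ l} ∧ w.length ≤ Q ∧
    x = headState lab false true false l r cur (fun _ => false) w c o

theorem exists_isHead_of_start (hL : l.Nodup) (hlab : ∀ i ∈ l, ∀ b, none ∉ lab i b)
    (hQ : ∀ i ∈ l, ∀ b, (lab i b).length ≤ Q) {cur : ι → Bool} {e : ι} (he : e ∈ l)
    (hp : IsPlaced lab l.toFinset cur e)
    (hc : ∀ f : ι → Bool, Set.InjOn (fun i => lab i (f i)) {i | i ∈ l ++ r} →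
      potential lab l.toFinset cur e f ≤ c) :
    ∃ x, IsHead lab Q l r c o x ∧ Exec scan (startState lab l r cur (fun i => decide (i = e))
      (lab e (cur e)).reverse c o) x (l.length * (30 * Q + 42) + 2) := by
  have hw : (lab e (cur e)).reverse.length ≤ Q := by
    simpa using hQ e he _
  by_cases h : ∃ j ∈ l, j ≠ e ∧ lab j (cur j) = lab e (cur e)
  · obtain ⟨j, hj, hje, hlj⟩ := h
    obtain ⟨l₁, l₂, rfl⟩ := List.append_of_mem hj
    refine ⟨_, Or.inl ⟨Function.update cur j (!cur j), j, hj,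
      hp.kick (List.mem_toFinset.2 hj) hje hlj, fun f hf => ?_, rfl⟩, ?_⟩
    · refine lt_of_lt_of_le (potential_kick_lt ?_ (List.mem_toFinset.2 he)
        (List.mem_toFinset.2 hj) hje hlj)
        (hc f hf)
      exact hf.mono fun i hi => List.mem_append_left _ (List.mem_toFinset.1 hi)
    · have h₁ := exec_scan_kick (B := B) (r := r) (cur := cur) (mov := fun i => decide (i = e))
        hlab hQ hL (fun i hi => ?_) (by simpa using hje) c o
      · rw [hlj] at h₁
        simpa using h₁
      · by_cases hie : i = e
        · exact Or.inl (by simpa using hie)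
        · refine Or.inr fun h => ?_
          -- The label has at most one occupant besides `e`, so `j` is the first edge that the pass
          -- finds.
          have hij := hp ⟨by simp [hi], hie⟩ ⟨by simp, hje⟩ h
          subst hij
          exact (List.nodup_append.1 hL).2.2 i hi i (by simp) rfl
  · push Not at h
    refine ⟨_, Or.inr ⟨cur, _, ?_, hw, rfl⟩, exec_scan_none hlab hQ hw (fun i hi => ?_) c o⟩
    · refine (hp.injOn fun j hj => h j (by simpa using hj)).mono fun i hi => ?_
      simpa using hi
    · by_cases hie : i = e
      · exact Or.inl (by simpa using hie)
      · exact Or.inr fun h' => h i hi hie (List.reverse_injective h')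

/-- The measure `c + r.length * (Q + 1)` decreases with every pass: a kick burns one unit of fuel,
and an insertion shortens `r` by one edge while adding at most `Q` units. The other factor of the
time bound is the cost of one round, and `n` also bounds the fuel left at the end. -/
theorem exec_insertAll_of_isHead (hL : L.Nodup) (hlab : ∀ i ∈ L, ∀ b, none ∉ lab i b)
    (hQ : ∀ i ∈ L, ∀ b, (lab i b).length ≤ Q) (hQ' : (L.flatMap (edgeCode lab)).length ≤ Q)
    (n : ℕ) : ∀ {l r : List ι} {c : ℕ} {x : State CuckooStack (Option Bool) B CuckooMem},
      IsHead lab Q l r c o x → l ++ r = L → c + r.length * (Q + 1) ≤ n →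
      ∃ y, IsFinal lab Q n L o y ∧ Exec insertAll x y ((n + 1) * (30 * Q ^ 2 + 63 * Q + 30)) := by
  have pass : ∀ {l r : List ι} {c : ℕ} {found : Bool} {cur : ι → Bool} {e : ι}
      {x : State CuckooStack (Option Bool) B CuckooMem}, l ++ r = L → x.var.go = true →
      Exec advance x (headState lab found true false l r cur (fun i => decide (i = e))
        (lab e (cur e)).reverse c o) (14 * Q + 19) → e ∈ l → IsPlaced lab l.toFinset cur e →
      (∀ f : ι → Bool, Set.InjOn (fun i => lab i (f i)) {i | i ∈ l ++ r} →
        potential lab l.toFinset cur e f ≤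
          bif found then c else c + (l.flatMap (edgeCode lab)).length) →
      ∃ y, IsHead lab Q l r (bif found then c else c + (l.flatMap (edgeCode lab)).length) o y ∧
        ∀ z t, Exec insertAll y z t → Exec insertAll x z (30 * Q ^ 2 + 63 * Q + 30 + t) := by
    intro l r c found cur e x hlr hgo hadv he hp hc
    have hsub : ∀ i ∈ l, i ∈ L := fun i hi => hlr ▸ List.mem_append_left _ hi
    obtain ⟨y, hy, hscan⟩ := exists_isHead_of_start (o := o)
      (hL := (List.nodup_append.1 (hlr ▸ hL)).1)
      (fun i hi => hlab i (hsub i hi)) (fun i hi => hQ i (hsub i hi)) he hp hc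
    have hlen : (l.flatMap (edgeCode lab)).length ≤ Q := by
      refine le_trans ?_ hQ'
      rw [← hlr]
      simp
    have hlen' := two_mul_length_le lab l
    refine ⟨y, hy, fun z t hz => (Exec.loop_step hgo (hadv.seq
      (Exec.ite_true rfl ((exec_rewind found l r _ c o).seq hscan))) hz).mono ?_⟩
    have : l.length * (30 * Q + 42) ≤ Q * (30 * Q + 42) := Nat.mul_le_mul_right _ (by omega)
    nlinarith
  have finish : ∀ {x y : State CuckooStack (Option Bool) B CuckooMem} {m : ℕ},
      x.var.go = true → y.var.go = false → Exec advance x y 4 →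
      Exec insertAll x y ((m + 1) * (30 * Q ^ 2 + 63 * Q + 30)) := by
    intro x y m hx hy h
    refine (Exec.loop_step hx (h.seq (Exec.ite_false hy (exec_skip _)))
      (Exec.loop_exit hy)).mono ?_
    nlinarith [Nat.zero_le (m * (30 * Q ^ 2 + 63 * Q + 30)), Nat.zero_le (Q ^ 2)]
  induction n using Nat.strong_induction_on with
  | h n ih =>
    rintro l r c x (⟨cur, e, he, hp, hc, rfl⟩ | ⟨cur, w, hinj, hw, rfl⟩) hlr hn
    · have hc' := hc
      rw [hlr] at hc'
      cases c with
      | zero =>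
        refine ⟨_, ⟨true, false, l, r, cur, fun i => decide (i = e), (lab e (cur e)).reverse, 0,
          rfl, hlr, ?_, by omega, by simp, ?_⟩, finish rfl rfl (exec_advance_fail _ _ _ _)⟩
        · simpa using hQ e (hlr ▸ List.mem_append_left _ he) _
        · rintro - ⟨f, hf⟩
          exact absurd (hc' f hf) (Nat.not_lt_zero _)
      | succ c =>
        obtain ⟨m, rfl⟩ : ∃ m, n = m + 1 := ⟨n - 1, by omega⟩
        obtain ⟨y, hy, hxy⟩ := pass (c := c) hlr rfl
          ((exec_advance_fuel l r _ c o).mono (by omega)) he hp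
          fun f hf => Nat.le_of_lt_succ (hc f hf)
        obtain ⟨z, hz, hyz⟩ := ih m (by omega) hy hlr (by
          simp only [cond_true]
          omega)
        refine ⟨z, hz.mono (by omega), (hxy z _ hyz).mono ?_⟩
        ring_nf
        omega
    · cases r with
      | nil =>
        rw [List.append_nil] at hlr
        subst hlr
        exact ⟨_, ⟨false, true, l, [], cur, fun _ => false, w, c, rfl, by simp, hw,
          (Nat.le_add_right _ _).trans hn, fun _ => ⟨rfl, hinj⟩, by simp⟩,
          finish rfl rfl (exec_advance_done _ _ _ _)⟩
      | cons i r =>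
        simp only [List.length_cons, Nat.add_mul, one_mul] at hn
        obtain ⟨m, rfl⟩ : ∃ m, n = m + 1 := ⟨n - 1, by omega⟩
        have hi : i ∉ l := fun h =>
          (List.nodup_append.1 (hlr ▸ hL)).2.2 i h i (by simp) rfl
        have hiL : i ∈ L := hlr ▸ by simp
        have hlr' : (l ++ [i]) ++ r = L := by simpa using hlr
        have hlen : ((l ++ [i]).flatMap (edgeCode lab)).length ≤ Q := by
          refine le_trans ?_ hQ'
          simp only [← hlr', List.flatMap_append, List.length_append]
          omega
        obtain ⟨y, hy, hxy⟩ := pass (c := c) (cur := Function.update cur i true) (e := i) hlr' rfl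
          (by simpa using exec_advance_insert (hlab i hiL) hi (hQ i hiL) hw r c o) (by simp)
          (by
            have h : (l ++ [i]).toFinset = insert i l.toFinset := by
              ext k
              simp
            rw [h]
            exact isPlaced_insert (by simpa using hinj) true)
          (fun f hf => by
            refine (potential_le (by simp)).trans ?_
            have := two_mul_length_le lab (l ++ [i])
            have := List.toFinset_card_le (l ++ [i])
            simp only [cond_false]
            omega)
        obtain ⟨z, hz, hyz⟩ := ih m (by omega) hy hlr' (by
          simp only [cond_false]
          omega)
        refine ⟨z, hz.mono (by omega), (hxy z _ hyz).mono ?_⟩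
        ring_nf
        omega

end StackProg

/-! ### The complete decision and search programs. -/

namespace StackProg

variable {ι : Type} {lab : ι → Bool → List (Option Bool)} {cur mov : ι → Bool} {L : List ι}

/-- Empty the stacks and the memory. -/
def clearAll {B : Type} : CuckooProg B :=
  .seq (clear .inp) (.seq (clear .past) (.seq (clear .seen) (.seq (clear .goal)
    (.seq (clear .fuel) (.load fun _ => cuckooMem false false false)))))

/-- Write out the first flags of the edges and their negations. -/
def writeAnswer : CuckooProg Bool :=
  -- The second flag lies on top and is overwritten by the first. The edges come last to first and
  -- the negation is emitted first, because the output is a stack.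
  drain .seen (.seq (read .seen) (.seq (.emit fun v => !(v.buf == some (some true)))
    (.emit fun v => v.buf == some (some true))))

/-- Decide whether different labels can be chosen for all the edges. -/
def decideProg : CuckooProg Bool :=
  .seq (.load fun v => { v with go := true }) (.seq insertAll (.seq (.emit fun v => v.ok) clearAll))

/-- Choose different labels for all the edges, if this is possible. -/
def searchProg : CuckooProg Bool :=
  .seq (.load fun v => { v with go := true })
    (.seq insertAll (.seq (.ite (fun v => v.ok) writeAnswer skip) clearAll))

/-- The number of steps of the two programs on an input of length `Q`. -/
def cuckooTime (Q : ℕ) : ℕ :=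
  -- The number of rounds, for at most `Q` edges, times the cost of a round, plus output and
  -- cleanup.
  (Q * (Q + 1) + 1) * (30 * Q ^ 2 + 63 * Q + 30) + (3 * Q ^ 2 + 20 * Q + 20)

/-- The polynomial of which `cuckooTime` is the evaluation. -/
noncomputable def cuckooTimePoly : Polynomial ℕ :=
  (.X * (.X + 1) + 1) * (30 * .X ^ 2 + 63 * .X + 30) + (3 * .X ^ 2 + 20 * .X + 20)

theorem eval_cuckooTimePoly (Q : ℕ) : cuckooTimePoly.eval Q = cuckooTime Q := by
  simp [cuckooTimePoly, cuckooTime]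

theorem exec_clearAll {B : Type} (v : CuckooMem) (i p g w c : List (Option Bool)) (o : List B) :
    Exec clearAll ⟨v, cuckooStacks i p [] g [] [] w [] c, o⟩
      ⟨cuckooMem false false false, fun _ => [], o⟩
      (3 * (i.length + p.length + g.length + w.length + c.length) + 11) := by
  refine ((exec_clear _ _ _ _).seq ((exec_clear _ _ _ _).seq ((exec_clear _ _ _ _).seq
    ((exec_clear _ _ _ _).seq ((exec_clear _ _ _ _).seq (exec_load _ _ _ _)))))).congr ?_ ?_
  · simp only [update_inp, update_past, update_seen, update_goal, update_fuel]
    congr 1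
    funext k
    cases k <;> rfl
  · simp
    omega

theorem exec_writeAnswer (v : CuckooMem) (i p h t w z c : List (Option Bool)) (l : List ι)
    (o : List Bool) :
    Exec writeAnswer ⟨v, cuckooStacks i p [] (l.flatMap (flagCode cur mov)).reverse h t w z c, o⟩
      ⟨{ v with buf := none }, cuckooStacks i p [] [] h t w z c,
        (l.flatMap fun i => [cur i, !cur i]) ++ o⟩ (5 * l.length + 2) := by
  induction l using List.reverseRecOn generalizing v o with
  | nil => exact exec_drain_nil rfl
  | append_singleton l a ih =>
    have h := ih { v with buf := some (some (cur a)) } (cur a :: (!cur a) :: o)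
    refine (exec_drain_cons (k := CuckooStack.seen) (a := some (mov a))
      (l := some (cur a) :: (l.flatMap (flagCode cur mov)).reverse) ?_ (Exec.congr
        ((exec_pop _ _ _ _ _).seq ((exec_emit _ _ _ _).seq (exec_emit _ _ _ _))) ?_ le_rfl)
          h).congr ?_ ?_
    · simp [flagCode]
    · cases cur a <;> simp
    · simp
    · simp only [List.length_append, List.length_singleton]
      omega

theorem length_le_length_flatMap {i : ι} (hi : i ∈ L) (b : Bool) :
    (lab i b).length ≤ (L.flatMap (edgeCode lab)).length := by
  obtain ⟨l₁, l₂, rfl⟩ := List.append_of_mem hi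
  cases b <;> simp [edgeCode] <;> omega

theorem exec_insertAll [DecidableEq ι] (hL : L.Nodup) (hlab : ∀ i ∈ L, ∀ b, none ∉ lab i b)
    {Q : ℕ} (hQ : (L.flatMap (edgeCode lab)).length = Q) (o : List Bool) :
    ∃ y, IsFinal lab Q (Q * (Q + 1)) L o y ∧
      Exec (.seq (.load fun v => { v with go := true }) insertAll)
        ⟨cuckooMem false false false,
          Function.update (fun _ => []) .inp (L.flatMap (edgeCode lab)), o⟩ y
        ((Q * (Q + 1) + 1) * (30 * Q ^ 2 + 63 * Q + 30) + 1) := by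
  have hl := two_mul_length_le lab L
  obtain ⟨y, hy, h⟩ := exec_insertAll_of_isHead (Q := Q) (o := o) hL hlab
    (fun i hi b => hQ ▸ length_le_length_flatMap hi b) hQ.le (Q * (Q + 1)) (l := []) (r := L)
    -- The initial state counts as a successful pass over no edges, with no fuel.
    (c := 0) (Or.inr ⟨fun _ => true, [], by simp, by simp, rfl⟩) (List.nil_append L) (by
      rw [zero_add]
      exact Nat.mul_le_mul_right _ (by omega))
  refine ⟨y, hy, ((exec_load _ _ _ _).seq (Exec.congr_left ?_ h)).mono (by omega)⟩
  unfold headState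
  congr 1
  funext k
  cases k <;> simp

theorem cleanup_le {Q : ℕ} (hQ : (L.flatMap (edgeCode lab)).length = Q)
    {l r : List ι} {w : List (Option Bool)} {c : ℕ} (hlr : l ++ r = L) (hw : w.length ≤ Q)
    (hc : c ≤ Q * (Q + 1)) :
    3 * ((r.flatMap (edgeCode lab)).length + (l.flatMap (edgeCode lab)).reverse.length +
      (l.flatMap (flagCode cur mov)).reverse.length + w.length +
      (List.replicate c (none : Option Bool)).length) + 11 ≤ 3 * Q ^ 2 + 12 * Q + 11 := by
  have hl := two_mul_length_le lab l
  have h : (l.flatMap (edgeCode lab)).length + (r.flatMap (edgeCode lab)).length = Q := by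
    rw [← hQ, ← hlr, List.flatMap_append, List.length_append]
  simp only [List.length_reverse, length_flatMap_flagCode, List.length_replicate]
  nlinarith

theorem exec_decideProg [DecidableEq ι] (hL : L.Nodup) (hlab : ∀ i ∈ L, ∀ b, none ∉ lab i b) :
    ∃ ok : Bool, (ok = true ↔ ∃ f : ι → Bool, Set.InjOn (fun i => lab i (f i)) {i | i ∈ L}) ∧
      Exec decideProg ⟨cuckooMem false false false,
          Function.update (fun _ => []) .inp (L.flatMap (edgeCode lab)), []⟩
        ⟨cuckooMem false false false, fun _ => [], [ok]⟩
        (cuckooTime (L.flatMap (edgeCode lab)).length) := by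
  obtain ⟨y, ⟨found, ok, l, r, cur, mov, w, c, rfl, hlr, hw, hc, h₁, h₂⟩, h⟩ :=
    exec_insertAll hL hlab rfl []
  refine ⟨ok, ⟨fun hok => ⟨cur, (h₁ hok).2⟩, fun hf => ?_⟩, ?_⟩
  · by_contra hok
    exact h₂ (by simpa using hok) hf
  -- The run is cut after the initial `load`, because `decideProg` brackets the sequence
  -- differently.
  · obtain ⟨s, hs, h⟩ := h
    cases h with
    | seq h₃ h₄ =>
      have h₅ := cleanup_le (cur := cur) (mov := mov) rfl hlr hw hc
      refine (Exec.seq ⟨_, le_rfl, h₃⟩ (Exec.seq ⟨_, le_rfl, h₄⟩ ((exec_emit _ _ _ _).seq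
        (exec_clearAll _ _ _ _ _ _ _)))).congr rfl ?_
      unfold cuckooTime
      omega

theorem exec_searchProg [DecidableEq ι] (hL : L.Nodup) (hlab : ∀ i ∈ L, ∀ b, none ∉ lab i b) :
    ∃ ans : Option (ι → Bool),
      (∀ f, ans = some f → Set.InjOn (fun i => lab i (f i)) {i | i ∈ L}) ∧
      ((∃ f : ι → Bool, Set.InjOn (fun i => lab i (f i)) {i | i ∈ L}) → ∃ f, ans = some f) ∧
      Exec searchProg ⟨cuckooMem false false false,
          Function.update (fun _ => []) .inp (L.flatMap (edgeCode lab)), []⟩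
        ⟨cuckooMem false false false, fun _ => [],
          ans.elim [] fun f => L.flatMap fun i => [f i, !f i]⟩
        (cuckooTime (L.flatMap (edgeCode lab)).length) := by
  obtain ⟨y, ⟨found, ok, l, r, cur, mov, w, c, rfl, hlr, hw, hc, h₁, h₂⟩, h⟩ :=
    exec_insertAll hL hlab rfl []
  have h₅ := cleanup_le (cur := cur) (mov := mov) rfl hlr hw hc
  obtain ⟨s, hs, h⟩ := h
  cases h with
  | seq h₃ h₄ =>
    cases ok with
    | false =>
      refine ⟨none, by simp, fun hf => absurd hf (h₂ rfl), ?_⟩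
      refine (Exec.seq ⟨_, le_rfl, h₃⟩ (Exec.seq ⟨_, le_rfl, h₄⟩ ((Exec.ite_false rfl
        (exec_skip _)).seq (exec_clearAll _ _ _ _ _ _ _)))).congr rfl ?_
      unfold cuckooTime
      omega
    | true =>
      obtain ⟨rfl, hinj⟩ := h₁ rfl
      rw [List.append_nil] at hlr
      subst hlr
      refine ⟨some cur, fun f hf => Option.some_injective _ hf ▸ hinj, fun _ => ⟨cur, rfl⟩, ?_⟩
      refine (Exec.seq ⟨_, le_rfl, h₃⟩ (Exec.seq ⟨_, le_rfl, h₄⟩ ((Exec.ite_true rfl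
        (exec_writeAnswer _ _ _ _ _ _ _ _ _ _)).seq (exec_clearAll _ _ _ _ _ _ _)))).congr ?_ ?_
      · simp
      · have hl := two_mul_length_le lab l
        simp only [List.length_nil]
        unfold cuckooTime
        omega

end StackProg

/-! ### Facets of the cross-polytope as choices of signs. -/

section Geometry

variable {d : ℕ}

theorem CrossVertex.pos_not (i : Fin (d + 1)) (b : Bool) :
    CrossVertex.pos (d := d) (i, !b) = -CrossVertex.pos (i, b) := by
  cases b <;> simp [CrossVertex.pos]

theorem CrossVertex.pos_mem (v : CrossVertex d) : v.pos ∈ crossPolytope d :=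
  subset_convexHull ℝ _ ⟨v, rfl⟩

/-- A proper face of the cross-polytope contains at most one of two antipodal vertices. -/
theorem IsCrossBoundarySimplex.eq_of_mem {s : Finset (CrossVertex d)}
    (hs : IsCrossBoundarySimplex s) {i : Fin (d + 1)} {b c : Bool} (hb : (i, b) ∈ s)
    (hc : (i, c) ∈ s) : b = c := by
  by_contra hbc
  obtain ⟨⟨v, hv⟩, hexp, hne⟩ := hs
  obtain ⟨l, hl⟩ := hexp ⟨_, subset_convexHull ℝ _ ⟨v, hv, rfl⟩⟩
  have hmax : ∀ v ∈ s, ∀ y ∈ crossPolytope d, l y ≤ l v.pos := by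
    intro v hv
    have : v.pos ∈ convexHull ℝ (CrossVertex.pos '' (s : Set (CrossVertex d))) :=
      subset_convexHull ℝ _ ⟨v, hv, rfl⟩
    rw [hl] at this
    exact this.2
  have hcb : c = !b := by cases b <;> cases c <;> simp_all
  subst hcb
  -- Both antipodal vertices maximize `l` and their values are opposite, so the maximum is zero. By
  -- symmetry `l` vanishes on the whole polytope, which is then the exposed face.
  have hle : ∀ y ∈ crossPolytope d, l y ≤ 0 := by
    intro y hy
    have h₁ := hmax _ hb y hy
    have h₂ := hmax _ hc y hy
    rw [CrossVertex.pos_not, map_neg] at h₂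
    linarith
  have hge : crossPolytope d ⊆ {x | 0 ≤ l x} := by
    refine convexHull_min ?_ (convex_halfSpace_ge l.isLinear 0)
    rintro _ ⟨⟨j, a⟩, rfl⟩
    have h := hle _ (CrossVertex.pos_mem (j, !a))
    rw [CrossVertex.pos_not, map_neg] at h
    simpa using h
  refine hne (Set.Subset.antisymm (convexHull_mono (Set.image_subset_range _ _)) ?_)
  rw [hl]
  exact fun x hx => ⟨hx, fun y hy => (hle y hy).trans (hge hx)⟩

/-- The set of vertices that contains the vertex with sign `c i` on the `i`-th axis. -/
def crossFacet (c : Fin (d + 1) → Bool) : Finset (CrossVertex d) :=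
  Finset.univ.image fun i => (i, c i)

theorem mem_crossFacet {c : Fin (d + 1) → Bool} {v : CrossVertex d} :
    v ∈ crossFacet c ↔ v.2 = c v.1 := by
  obtain ⟨i, b⟩ := v
  simp [crossFacet, eq_comm]

theorem card_crossFacet (c : Fin (d + 1) → Bool) : (crossFacet c).card = d + 1 := by
  rw [crossFacet, Finset.card_image_of_injective _ fun i j h => congrArg Prod.fst h]
  simp

/-- The functional whose maximum on the cross-polytope is attained on a given facet. -/
noncomputable def facetFunctional (c : Fin (d + 1) → Bool) :
    EuclideanSpace ℝ (Fin (d + 1)) →L[ℝ] ℝ :=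
  ∑ i, (if c i then (1 : ℝ) else -1) • EuclideanSpace.proj i

theorem facetFunctional_pos (c : Fin (d + 1) → Bool) (v : CrossVertex d) :
    facetFunctional c v.pos = if v.2 = c v.1 then 1 else -1 := by
  obtain ⟨i, b⟩ := v
  have h : facetFunctional c (EuclideanSpace.single i 1) = if c i then (1 : ℝ) else -1 := by
    have hp : ∀ j, EuclideanSpace.proj (𝕜 := ℝ) j (EuclideanSpace.single i (1 : ℝ)) =
        if j = i then 1 else 0 := fun j => PiLp.single_apply 2 ℝ i 1 j
    rw [facetFunctional, sum_apply]
    simp only [smul_apply, hp, smul_eq_mul, mul_ite, mul_one, mul_zero, Finset.sum_ite_eq',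
      Finset.mem_univ, if_true]
  cases b <;> cases hc : c i <;> simp [CrossVertex.pos, h, hc]

/-- The signed sum of the coordinates is `1` at the chosen vertices and `-1` at the others, so it
exposes their hull, and the hull misses the other vertices. -/
theorem isCrossBoundarySimplex_crossFacet (c : Fin (d + 1) → Bool) :
    IsCrossBoundarySimplex (crossFacet c) := by
  have hle : ∀ y ∈ crossPolytope d, facetFunctional c y ≤ 1 := by
    have : crossPolytope d ⊆ {x | facetFunctional c x ≤ 1} := by
      refine convexHull_min ?_ (convex_halfSpace_le (facetFunctional c).isLinear 1)
      rintro _ ⟨v, rfl⟩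
      rw [Set.mem_ofPred_eq, facetFunctional_pos]
      split_ifs <;> norm_num
    exact this
  have heq : ∀ y ∈ convexHull ℝ (CrossVertex.pos '' (crossFacet c : Set (CrossVertex d))),
      facetFunctional c y = 1 := by
    have : convexHull ℝ (CrossVertex.pos '' (crossFacet c : Set (CrossVertex d))) ⊆
        {x | facetFunctional c x = 1} := by
      refine convexHull_min ?_ (convex_hyperplane (facetFunctional c).isLinear 1)
      rintro _ ⟨v, hv, rfl⟩
      rw [Set.mem_ofPred_eq, facetFunctional_pos, if_pos (mem_crossFacet.1 hv)]
    exact this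
  refine ⟨⟨(0, c 0), mem_crossFacet.2 rfl⟩, fun _ => ⟨facetFunctional c, ?_⟩, fun h => ?_⟩
  · refine Set.Subset.antisymm (fun x hx => ⟨convexHull_mono (Set.image_subset_range _ _) hx,
      fun y hy => (hle y hy).trans (heq x hx).ge⟩) ?_
    rintro x ⟨hx, hmax⟩
    have h₁ : facetFunctional c x = 1 := by
      refine le_antisymm (hle x hx) ?_
      have h := hmax _ (CrossVertex.pos_mem (0, c 0))
      rwa [facetFunctional_pos, if_pos rfl] at h
    obtain ⟨κ, _, w, z, hw₀, hw₁, hz, rfl⟩ := mem_convexHull_iff_exists_fintype.1 hx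
    choose v hv using hz
    -- A convex combination attaining the maximum `1` gives positive weight only to vertices that
    -- attain it: the nonnegative defects sum to zero.
    have hw : ∀ i, w i ≠ 0 → v i ∈ crossFacet c := by
      intro i hi
      by_contra hvi
      have h₂ : ∑ i, w i * (1 - facetFunctional c (z i)) = 0 := by
        simp only [map_sum, map_smul, smul_eq_mul] at h₁
        simp only [mul_sub, mul_one, Finset.sum_sub_distrib, hw₁, h₁, sub_self]
      have h₃ := (Finset.sum_eq_zero_iff_of_nonneg fun i _ => mul_nonneg (hw₀ i) (by
        rw [← hv i, facetFunctional_pos]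
        split_ifs <;> norm_num)).1 h₂ i (Finset.mem_univ i)
      rw [← hv i, facetFunctional_pos, if_neg fun h => hvi (mem_crossFacet.2 h)] at h₃
      norm_num at h₃
      exact hi h₃
    rw [← Fintype.sum_subset (s := {i | w i ≠ 0}) fun i hi =>
      Finset.mem_filter.2 ⟨Finset.mem_univ _, left_ne_zero_of_smul hi⟩]
    exact (convex_convexHull ..).sum_mem (fun i _ => hw₀ i) (by rwa [Finset.sum_filter_ne_zero])
      fun i hi => subset_convexHull ℝ _ ⟨v i, hw i (Finset.mem_filter.1 hi).2, hv i⟩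
  · have h₁ := heq _ (h ▸ CrossVertex.pos_mem (0, !c 0))
    rw [facetFunctional_pos, if_neg (by simp)] at h₁
    norm_num at h₁

theorem isFullyLabeled_crossFacet {lab : CrossLabeling d} {c : Fin (d + 1) → Bool} :
    IsFullyLabeled lab (crossFacet c) ↔ Function.Injective fun i => lab (i, c i) := by
  constructor
  · rintro ⟨-, -, hinj⟩ i j hij
    exact congrArg Prod.fst (hinj (mem_crossFacet.2 rfl) (mem_crossFacet.2 rfl) hij)
  · intro hc
    refine ⟨isCrossBoundarySimplex_crossFacet c, card_crossFacet c, ?_⟩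
    rintro ⟨i, b⟩ hi ⟨j, b'⟩ hj hij
    obtain rfl : b = c i := mem_crossFacet.1 hi
    obtain rfl : b' = c j := mem_crossFacet.1 hj
    obtain rfl := hc hij
    rfl

/-- Without antipodal pairs, `s` lies in the facet of the signs that it contains, and the
cardinalities agree. -/
theorem IsFullyLabeled.exists_eq_crossFacet {lab : CrossLabeling d} {s : Finset (CrossVertex d)}
    (h : IsFullyLabeled lab s) : ∃ c : Fin (d + 1) → Bool, s = crossFacet c := by
  obtain ⟨hs, hcard, -⟩ := h
  refine ⟨fun i => decide ((i, true) ∈ s), Finset.eq_of_subset_of_card_le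
    (fun v hv => mem_crossFacet.2 ?_) ((card_crossFacet _).trans hcard.symm).le⟩
  obtain ⟨i, b⟩ := v
  cases b with
  | true => simpa using hv
  | false =>
    have : (i, true) ∉ s := fun h => Bool.noConfusion (hs.eq_of_mem hv h)
    simp [this]

end Geometry

/-! ### Translation between choices of ends and fully-labeled simplices. -/

open StackProg

/-- The code of the label of a vertex, without separator. -/
def vertexWord {d : ℕ} (lab : CrossLabeling d) (i : Fin (d + 1)) (b : Bool) : List (Option Bool) :=
  (Computability.encodeNat (lab (i, b))).map some

theorem vertexWord_inj {d : ℕ} {lab : CrossLabeling d} {i j : Fin (d + 1)} {a b : Bool} :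
    vertexWord lab i a = vertexWord lab j b ↔ lab (i, a) = lab (j, b) := by
  refine ⟨fun h => ?_, fun h => by rw [vertexWord, vertexWord, h]⟩
  have h' := congrArg Computability.decodeNat
    (List.map_injective_iff.2 (Option.some_injective Bool) h)
  simpa [Fin.val_inj] using h'

theorem encodeLabeledCrossPolytope_eq (I : LabeledCrossPolytope) :
    encodeLabeledCrossPolytope I =
      (List.finRange (I.d + 1)).flatMap (edgeCode (vertexWord I.label)) := by
  simp [encodeLabeledCrossPolytope, encodeCrossLabel]
  rfl

theorem elim_eq_encodeCrossAnswer {d : ℕ} (ans : Option (Fin (d + 1) → Bool)) :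
    (ans.elim [] fun f => (List.finRange (d + 1)).flatMap fun i => [f i, !f i]) =
      encodeCrossAnswer (ans.map crossFacet) := by
  cases ans with
  | none => rfl
  | some f =>
    refine List.flatMap_congr fun i _ => ?_
    cases h : f i <;> simp [mem_crossFacet, h]

theorem injOn_vertexWord_iff {d : ℕ} {lab : CrossLabeling d} {f : Fin (d + 1) → Bool} :
    Set.InjOn (fun i => vertexWord lab i (f i)) {i | i ∈ List.finRange (d + 1)} ↔
      IsFullyLabeled lab (crossFacet f) := by
  rw [isFullyLabeled_crossFacet]
  constructor
  · exact fun h i j hij => h (List.mem_finRange i) (List.mem_finRange j) (vertexWord_inj.2 hij)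
  · exact fun h i _ j _ hij => h (vertexWord_inj.1 hij)

theorem exists_injOn_iff {d : ℕ} {lab : CrossLabeling d} :
    (∃ f : Fin (d + 1) → Bool,
      Set.InjOn (fun i => vertexWord lab i (f i)) {i | i ∈ List.finRange (d + 1)}) ↔
        ∃ s, IsFullyLabeled lab s := by
  simp only [injOn_vertexWord_iff]
  constructor
  · rintro ⟨f, hf⟩
    exact ⟨_, hf⟩
  · rintro ⟨s, hs⟩
    obtain ⟨f, rfl⟩ := hs.exists_eq_crossFacet
    exact ⟨f, hs⟩

/-- Deciding whether a fully-labeled simplex exists, and finding one if there is one, can be done by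
Turing machines in time polynomial in the length of the input. -/
theorem mainTheorem10 :
    (∃ decideFull : LabeledCrossPolytope → Bool,
      Nonempty (Turing.TM2ComputableInPolyTime encodeLabeledCrossPolytope
        Computability.encodeBool decideFull) ∧
      ∀ I : LabeledCrossPolytope, decideFull I = true ↔ ∃ s, IsFullyLabeled I.label s) ∧
    (∃ findFull : (I : LabeledCrossPolytope) → Option (Finset (CrossVertex I.d)),
      Nonempty (Turing.TM2ComputableInPolyTime encodeLabeledCrossPolytope
        (id : List Bool → List Bool) (fun I => encodeCrossAnswer (findFull I))) ∧
      ∀ I : LabeledCrossPolytope,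
        (∀ s, findFull I = some s → IsFullyLabeled I.label s) ∧
        ((∃ s, IsFullyLabeled I.label s) → ∃ s, findFull I = some s)) := by
  have hword : ∀ (I : LabeledCrossPolytope), ∀ i ∈ List.finRange (I.d + 1), ∀ b,
      none ∉ vertexWord I.label i b := by
    simp [vertexWord]
  constructor
  -- Only the answers are chosen instance by instance; the program and the time bound are the same
  -- for all of them.
  · choose ok h₁ h₂ using fun I : LabeledCrossPolytope =>
      exec_decideProg (List.nodup_finRange (I.d + 1)) (hword I)
    refine ⟨ok, nonempty_tm2ComputableInPolyTime decideProg .inp (cuckooMem false false false)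
      cuckooTimePoly fun I => ?_, fun I => (h₁ I).trans exists_injOn_iff⟩
    rw [encodeLabeledCrossPolytope_eq, eval_cuckooTimePoly]
    exact h₂ I
  · choose ans h₁ h₂ h₃ using fun I : LabeledCrossPolytope =>
      exec_searchProg (List.nodup_finRange (I.d + 1)) (hword I)
    refine ⟨fun I => (ans I).map crossFacet, nonempty_tm2ComputableInPolyTime searchProg .inp
      (cuckooMem false false false) cuckooTimePoly fun I => ?_,
      fun I => ⟨fun s hs => ?_, fun hs => ?_⟩⟩
    · rw [encodeLabeledCrossPolytope_eq, eval_cuckooTimePoly]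
      refine (h₃ I).congr ?_ le_rfl
      rw [elim_eq_encodeCrossAnswer]
      rfl
    · obtain ⟨f, hf, rfl⟩ := Option.map_eq_some_iff.1 hs
      exact injOn_vertexWord_iff.1 (h₁ I f hf)
    · obtain ⟨f, hf⟩ := h₂ I (exists_injOn_iff.2 hs)
      exact ⟨crossFacet f, by simp [hf]⟩
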